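/- Let $\mathfrak{L}$ be a finite-dimensional complex Lie algebra with a fixed Levi decomposition $\mathfrak{L}=\mathfrak{g}\ltimes\mathfrak{r}$, where $\mathfrak{g}$ is a semisimple subalgebra and $\mathfrak{r}$ is the radical of $\mathfrak{L}$, and assume that $\mathfrak{r}$ is abelian (a generalized Takiff algebra). Let $\overline{Z(\mathfrak{L})}:=Z(\mathfrak{L})\cap U(\mathfrak{r})$ be the purely radical part of the center $Z(\mathfrak{L})$ of the universal enveloping algebra $U(\mathfrak{L})$. A radical central character is an algebra homomorphism $\chi\colon\overline{Z(\mathfrak{L})}\to\mathbb{C}$; an $\mathfrak{L}$-module has radical central character $\chi$ if every $z\in\overline{Z(\mathfrak{L})}$ acts on it as the scalar $\chi(z)$. A simple $\mathfrak{g}$-module is a $\mathfrak{g}$-type of an $\mathfrak{L}$-module if it is isomorphic to one of its $\mathfrak{g}$-submodules. An $\mathfrak{L}$-module is $\mathfrak{g}$-Harish-Chandra if, as a $\mathfrak{g}$-module, it is a direct sum of simple finite-dimensional $\mathfrak{g}$-modules in which each isomorphism class occurs with finite multiplicity. Let $Q(0):=U(\mathfrak{L})\otimes_{U(\mathfrak{g})}\mathbb{C}$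 be the module induced from the trivial $\mathfrak{g}$-module, and put $Q(0,\chi):=Q(0)/\mathbf{m}_\chi Q(0)$ with $\mathbf{m}_\chi:=\ker\chi$. Fix a radical central character $\chi$. Then $Q(0,\chi)$ has a unique simple quotient $V(0,\chi)$, namely its quotient by the sum of all its proper submodules, and the following hold. 1. $V(0,\chi)$ is, up to isomorphism, the unique simple $\mathfrak{L}$-module having both radical central character $\chi$ and the trivial $\mathfrak{g}$-module as one of its $\mathfrak{g}$-types. 2. If $[\mathfrak{g},\mathfrak{r}]=\mathfrak{r}$, then $V(0,\chi)$ is either the trivial one-dimensional $\mathfrak{L}$-module or infinite-dimensional, and it is the trivial $\mathfrak{L}$-module precisely when $\chi$ is the radical central character of the trivial $\mathfrak{L}$-module. 3. $V(0,\chi)$ is a $\mathfrak{g}$-Harish-Chandra module. -/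

import Mathlib

open scoped TensorProduct

noncomputable section

namespace GenTakiff

universe u v w

attribute [local instance 100] LieRing.ofAssociativeRing

section General

variable (L : Type u) [LieRing L] [LieAlgebra ℂ L]

/-- The universal enveloping algebra `U(L)` over `ℂ`. -/
abbrev U : Type u := UniversalEnvelopingAlgebra ℂ L

/-- The action of `U(L)` on an `L`-module `W`, extending the action of `L`. -/
def uAct (W : Type w) [AddCommGroup W] [Module ℂ W] [LieRingModule L W] [LieModule ℂ L W] :
    U L →ₐ[ℂ] Module.End ℂ W :=
  UniversalEnvelopingAlgebra.lift ℂ (LieModule.toEnd ℂ L W)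

/-- The algebra homomorphism `U(r) → U(L)` induced by the inclusion of the radical
`r` of `L`. -/
def uRadIncl : U (LieAlgebra.radical ℂ L) →ₐ[ℂ] U L :=
  UniversalEnvelopingAlgebra.lift ℂ
    ((UniversalEnvelopingAlgebra.ι ℂ (L := L)).comp (LieAlgebra.radical ℂ L).incl)

/-- The purely radical part `Z(L) ∩ U(r)` of the center `Z(L)` of `U(L)`, where `r` is the
radical of `L`. -/
def radCenter : Subalgebra ℂ (U L) :=
  Subalgebra.center ℂ (U L) ⊓ (uRadIncl L).range

/-- A radical central character: an algebra homomorphism `Z(L) ∩ U(r) → ℂ`. -/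
abbrev RadCentralChar : Type u := radCenter L →ₐ[ℂ] ℂ

variable {L} in
/-- The `L`-module `W` has radical central character `χ`: every `z ∈ Z(L) ∩ U(r)` acts on `W` as
the scalar `χ z`. -/
def HasRadCentralChar (χ : RadCentralChar L)
    (W : Type w) [AddCommGroup W] [Module ℂ W] [LieRingModule L W] [LieModule ℂ L W] : Prop :=
  ∀ (z : radCenter L) (x : W), uAct L W (z : U L) x = χ z • x

/-- The trivial one-dimensional module. -/
abbrev Triv : Type := TrivialLieModule ℂ L ℂ

end General

variable {L : Type u} [LieRing L] [LieAlgebra ℂ L] (g : LieSubalgebra ℂ L)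

section Restriction

variable (W : Type w) [AddCommGroup W] [Module ℂ W] [LieRingModule L W] [LieModule ℂ L W]

/-- The simple `g`-module `S` is a `g`-type of the `L`-module `W`: some `g`-submodule of `W` is
isomorphic to `S`. -/
def HasType (S : Type v) [AddCommGroup S] [Module ℂ S] [LieRingModule g S] : Prop :=
  ∃ N : LieSubmodule ℂ g W, Nonempty (S ≃ₗ⁅ℂ, g⁆ N)

/-- The `L`-module `W` is a `g`-Harish-Chandra module: as a `g`-module, it is the internal direct
sum of a family of simple finite-dimensional `g`-submodules, in which each isomorphism class occurs
only finitely many times. -/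
def IsHarishChandra : Prop :=
  ∃ S : Set (LieSubmodule ℂ g W),
    (∀ N ∈ S, LieModule.IsIrreducible ℂ g N ∧ FiniteDimensional ℂ N) ∧
    sSupIndep S ∧ sSup S = ⊤ ∧
    ∀ N ∈ S, {N' ∈ S | Nonempty (N' ≃ₗ⁅ℂ, g⁆ N)}.Finite

end Restriction

section Induction

/-- The algebra homomorphism `U(g) → U(L)` induced by the inclusion of the subalgebra `g`. -/
def uIncl : U g →ₐ[ℂ] U L :=
  UniversalEnvelopingAlgebra.lift ℂ ((UniversalEnvelopingAlgebra.ι ℂ (L := L)).comp g.incl)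

variable (M : Type v) [AddCommGroup M] [Module ℂ M] [LieRingModule g M] [LieModule ℂ g M]

/-- The relations `u a ⊗ m = u ⊗ a m`, for `u ∈ U(L)` and `a ∈ U(g)`, by which `U(L) ⊗_ℂ M` is to
be divided to give `U(L) ⊗_{U(g)} M`. -/
def indRel : Submodule (U L) (U L ⊗[ℂ] M) :=
  Submodule.span (U L)
    {t | ∃ (b : U L) (a : U g) (m : M), t = (b * uIncl g a) ⊗ₜ[ℂ] m - b ⊗ₜ[ℂ] (uAct g M a m)}

/-- The induced module `Ind_g^L M = U(L) ⊗_{U(g)} M`. -/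
def Ind : Type (max u v) := (U L ⊗[ℂ] M) ⧸ indRel g M

instance : AddCommGroup (Ind g M) := inferInstanceAs (AddCommGroup ((U L ⊗[ℂ] M) ⧸ indRel g M))

instance : Module (U L) (Ind g M) := inferInstanceAs (Module (U L) ((U L ⊗[ℂ] M) ⧸ indRel g M))

instance : Module ℂ (Ind g M) := inferInstanceAs (Module ℂ ((U L ⊗[ℂ] M) ⧸ indRel g M))

instance : IsScalarTower ℂ (U L) (Ind g M) :=
  inferInstanceAs (IsScalarTower ℂ (U L) ((U L ⊗[ℂ] M) ⧸ indRel g M))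

/-- `L` acts on `U(L) ⊗_{U(g)} M` by left multiplication on the first factor. -/
instance : LieRingModule L (Ind g M) where
  bracket x m := UniversalEnvelopingAlgebra.ι ℂ x • m
  add_lie x y m := by
    change UniversalEnvelopingAlgebra.ι ℂ (x + y) • m = _
    rw [map_add, add_smul]
  lie_add x m n := smul_add _ m n
  leibniz_lie x y m := by
    change UniversalEnvelopingAlgebra.ι ℂ x • UniversalEnvelopingAlgebra.ι ℂ y • m =
      UniversalEnvelopingAlgebra.ι ℂ ⁅x, y⁆ • m +
        UniversalEnvelopingAlgebra.ι ℂ y • UniversalEnvelopingAlgebra.ι ℂ x • m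
    rw [LieHom.map_lie, LieRing.of_associative_ring_bracket, sub_smul, mul_smul, mul_smul,
      sub_add_cancel]

instance : LieModule ℂ L (Ind g M) where
  smul_lie t x m := by
    change UniversalEnvelopingAlgebra.ι ℂ (t • x) • m = t • (UniversalEnvelopingAlgebra.ι ℂ x • m)
    rw [map_smul, smul_assoc]
  lie_smul t x m := by
    change UniversalEnvelopingAlgebra.ι ℂ x • (t • m) = t • (UniversalEnvelopingAlgebra.ι ℂ x • m)
    exact smul_algebra_smul_comm t (UniversalEnvelopingAlgebra.ι ℂ x) m

end Induction

/-- The universal module `Q(0) = U(L) ⊗_{U(g)} L(0)`, where `L(0)` is the trivial `g`-module. -/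
abbrev Q0 : Type u := Ind g (Triv g)

/-- The submodule `m_χ Q(0)` of `Q(0)`, where `m_χ` is the kernel of `χ`. -/
def mQ (χ : RadCentralChar L) : LieSubmodule ℂ L (Q0 g) :=
  LieSubmodule.lieSpan ℂ L
    {q | ∃ (z : radCenter L) (p : Q0 g), χ z = 0 ∧ q = uAct L (Q0 g) (z : U L) p}

/-- The universal module `Q(0, χ) = Q(0) / m_χ Q(0)`. -/
abbrev Q (χ : RadCentralChar L) : Type u := Q0 g ⧸ mQ g χ

/-- The sum of all proper submodules of `Q(0, χ)`. -/
def maxSub (χ : RadCentralChar L) : LieSubmodule ℂ L (Q g χ) :=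
  sSup {N | N ≠ ⊤}

/-- The quotient `V(0, χ)` of `Q(0, χ)` by the sum of all its proper submodules. -/
abbrev V (χ : RadCentralChar L) : Type u := Q g χ ⧸ maxSub g χ

end GenTakiff

end

open GenTakiff

/-! Write `r` for the radical and `A` for the image of `U(r)` in `U(L)` (`radAlg`). The adjoint
action of `g` on `A` is locally finite, because `L` is finite-dimensional, and as `r` is abelian the
`g`-invariants of `A` are exactly `Z(L) ∩ U(r)`, on which `χ` is defined.

The main tool is the Reynolds splitting of a locally finite `g`-module as `X = X^g ⊕ gX`
(`exists_add_eq`, `eq_zero_of_mem_lieRange`). It follows from the vanishing of first cohomology,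
proved with Casimir operators, and from Weyl's theorem.

Suppose that a `g`-invariant vector `w₀` generates a module `W` of character `χ`
(`IsSphericalVector`). Acting on `w₀` gives a `g`-equivariant surjection `A → W`. Invariants of `A`
act by scalars, so the splitting yields `W^g = ℂ w₀`. A proper submodule then has no nonzero
invariants and lies in `gW`, which misses `w₀` when `w₀ ≠ 0`, so the sum of all proper submodules is
proper (`IsSphericalVector.sSup_ne_top`). This gives the unique simple quotient, and uniqueness of
`V(0, χ)` follows from the universal property of `Q(0)`. That `Q(0, χ) ≠ 0` is `q₀_notMem`.

Finite multiplicities come from Hilbert's finiteness argument over the Noetherian ring `A`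
(`IsSphericalVector.finiteDimensional_hom`). For the dichotomy, `[g, r] = r` makes `r` act by zero
on any finite-dimensional simple module (`lie_radical_eq_zero`), so the spherical vector is
`L`-invariant. -/

namespace LieModule

universe w

open Module

/-! ### Casimir operators of an ideal with an invariant form -/

section Casimir

variable {K g : Type*} [Field K] [LieRing g] [LieAlgebra K g]
  {ι : Type*} [Fintype ι] {J : LieIdeal K g}

/-- The Casimir operator attached to two families of elements of an ideal. -/
noncomputable def casimir (b d : ι → J) (X : Type*) [AddCommGroup X] [Module K X]
    [LieRingModule g X] [LieModule K g X] : End K X :=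
  ∑ i, toEnd K g X (b i : g) * toEnd K g X (d i : g)

variable {X : Type*} [AddCommGroup X] [Module K X] [LieRingModule g X] [LieModule K g X]

lemma casimir_apply (b d : ι → J) (v : X) :
    casimir b d X v = ∑ i, ⁅(b i : g), ⁅(d i : g), v⁆⁆ := by
  simp [casimir]

-- Invariance of `B` makes the matrices of `x` in the basis and in the dual basis negative
-- transposes of each other, so the two sums cancel term by term. In other words, `∑ b i ⊗ d i` is
-- an invariant tensor.
omit [LieRingModule g X] [LieModule K g X] in
lemma sum_dualBasis_lie_add [DecidableEq ι] (B : LinearMap.BilinForm K J) (hB : B.Nondegenerate) (hs : B.IsSymm)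
    (hinv : ∀ (x : g) (a c : J), B ⁅x, a⁆ c = - B a ⁅x, c⁆) (b : Basis ι K J)
    (f : J →ₗ[K] J →ₗ[K] X) (x : g) :
    ∑ i, f ⁅x, b i⁆ (B.dualBasis hB b i) + ∑ i, f (b i) ⁅x, B.dualBasis hB b i⁆ = 0 := by
  set d := B.dualBasis hB b with hd
  have hb : ∀ y : J, y = ∑ j, B y (d j) • b j := fun y => by
    have := B.dualBasis_repr_apply hB d y
    rw [hd, LinearMap.BilinForm.dualBasis_dualBasis hB hs] at this
    conv_lhs => rw [← b.sum_repr y]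
    exact Finset.sum_congr rfl fun j _ => by rw [this j]
  have hd' : ∀ y : J, y = ∑ j, B y (b j) • d j := fun y => by
    conv_lhs => rw [← d.sum_repr y]
    exact Finset.sum_congr rfl fun j _ => by rw [hd, B.dualBasis_repr_apply hB b y]
  have h1 : ∀ i, f ⁅x, b i⁆ (d i) = ∑ j, B ⁅x, b i⁆ (d j) • f (b j) (d i) := fun i => by
    conv_lhs => rw [hb ⁅x, b i⁆]
    simp
  have h2 : ∀ i, f (b i) ⁅x, d i⁆ = ∑ j, B ⁅x, d i⁆ (b j) • f (b i) (d j) := fun i => by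
    conv_lhs => rw [hd' ⁅x, d i⁆]
    simp
  simp_rw [h1, h2]
  rw [Finset.sum_comm, ← Finset.sum_add_distrib]
  refine Finset.sum_eq_zero fun i _ => ?_
  rw [← Finset.sum_add_distrib]
  refine Finset.sum_eq_zero fun j _ => ?_
  rw [← add_smul, hinv, hs.eq, neg_add_cancel, zero_smul]

lemma casimir_lie [DecidableEq ι] (B : LinearMap.BilinForm K J) (hB : B.Nondegenerate) (hs : B.IsSymm)
    (hinv : ∀ (x : g) (a c : J), B ⁅x, a⁆ c = - B a ⁅x, c⁆) (b : Basis ι K J) (x : g) (v : X) :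
    casimir b (B.dualBasis hB b) X ⁅x, v⁆ = ⁅x, casimir b (B.dualBasis hB b) X v⁆ := by
  let f : J →ₗ[K] J →ₗ[K] X := LinearMap.mk₂ K (fun a c => ⁅(a : g), ⁅(c : g), v⁆⁆)
    (by simp) (by simp) (by simp) (by simp)
  have h := sum_dualBasis_lie_add B hB hs hinv b f x
  simp only [f, LinearMap.mk₂_apply, LieSubmodule.coe_bracket] at h
  rw [casimir_apply, casimir_apply, lie_sum, ← sub_eq_zero, ← neg_eq_zero, ← h,
    ← Finset.sum_sub_distrib, ← Finset.sum_add_distrib, ← Finset.sum_neg_distrib]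
  refine Finset.sum_congr rfl fun i _ => ?_
  rw [leibniz_lie x (b i : g), leibniz_lie x (B.dualBasis hB b i : g), lie_add]
  abel

end Casimir

/-! ### Vanishing of first cohomology and Weyl's theorem -/

section SemisimpleAlgebra

variable {K : Type*} {g : Type*} [Field K] [LieRing g] [LieAlgebra K g]
  [LieAlgebra.IsSemisimple K g]

lemma lie_self_of_isAtom {J : LieIdeal K g} (hJ : IsAtom J) : ⁅J, J⁆ = J :=
  lie_eq_self_of_isAtom_of_nonabelian J hJ
    (LieAlgebra.IsSemisimple.non_abelian_of_isAtom J hJ)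

lemma derivedSeries_one_of_isAtom {J : LieIdeal K g} (hJ : IsAtom J) :
    LieAlgebra.derivedSeries K J 1 = ⊤ := by
  have := LieAlgebra.IsSemisimple.isSimple_of_isAtom J hJ
  refine (LieAlgebra.IsSimple.eq_bot_or_eq_top _).resolve_left fun h => ?_
  refine LieAlgebra.IsSimple.non_abelian K (L := J) ?_
  rwa [LieAlgebra.abelian_iff_derived_one_eq_bot, ← LieIdeal.derivedSeries_eq_bot_iff]

variable {X : Type*} [AddCommGroup X] [Module K X] [LieRingModule g X] [LieModule K g X]

lemma lie_eq_zero_of_forall_isAtom {v : X}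
    (h : ∀ J : LieIdeal K g, IsAtom J → ∀ a ∈ J, ⁅a, v⁆ = 0) (x : g) : ⁅x, v⁆ = 0 := by
  have hx : x ∈ (sSup {I : LieIdeal K g | IsAtom I} : LieIdeal K g) := by
    rw [LieAlgebra.IsSemisimple.sSup_atoms_eq_top]; trivial
  rw [← LieSubmodule.mem_toSubmodule, LieSubmodule.sSup_toSubmodule] at hx
  have hle : sSup {((s : LieIdeal K g) : Submodule K g) | s ∈ {I : LieIdeal K g | IsAtom I}} ≤
      LinearMap.ker ((toEnd K g X : g →ₗ[K] End K X).flip v) := by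
    refine sSup_le ?_
    rintro _ ⟨J, hJ, rfl⟩ a ha
    simpa using h J hJ a ha
  simpa using hle hx

/-- Since `J = [J, J]`, every element of `J` is a sum of brackets, and these act as commutators of
pairs that kill `v`. -/
lemma lie_eq_zero_of_lie_lie_eq_zero {J : LieIdeal K g} (hJ : IsAtom J) {v : X}
    (h : ∀ a ∈ J, ∀ c ∈ J, ⁅a, ⁅c, v⁆⁆ = 0) (a : g) (ha : a ∈ J) : ⁅a, v⁆ = 0 := by
  rw [← lie_self_of_isAtom hJ, ← LieSubmodule.mem_toSubmodule,
    LieSubmodule.lieIdeal_oper_eq_linear_span'] at ha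
  have hle : Submodule.span K {m | ∃ x ∈ J, ∃ n ∈ J, ⁅x, n⁆ = m} ≤
      LinearMap.ker ((toEnd K g X : g →ₗ[K] End K X).flip v) := by
    rw [Submodule.span_le]
    rintro _ ⟨x, hx, y, hy, rfl⟩
    simp [h x hx y hy, h y hy x hx]
  simpa using hle ha

variable [CharZero K]

/-- The kernel of the form is an ideal of `g` inside the atom `J`, hence zero or `J`. In the second
case Cartan's criterion makes `J = [J, J]` act nilpotently on `W`, so `J` kills a nonzero vector.
The vectors of `W` killed by `J` form a `g`-submodule, so `J` kills all of `W`, contrary to `hne`.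
-/
lemma traceForm_nondegenerate_of_isAtom (W : LieSubmodule K g X) [FiniteDimensional K W]
    (hW : ∀ W' ≤ W, W' = ⊥ ∨ W' = W) {J : LieIdeal K g} (hJ : IsAtom J)
    (hne : ∃ a ∈ J, ∃ w ∈ W, ⁅a, w⁆ ≠ 0) : (traceForm K J W).Nondegenerate := by
  refine (traceForm_isSymm K J W).isRefl.nondegenerate_iff_separatingLeft.mpr ?_
  let I : LieIdeal K g :=
    { carrier := {a | a ∈ J ∧ ∀ c ∈ J, traceForm K g W a c = 0}
      add_mem' := fun ha hc => ⟨add_mem ha.1 hc.1, fun e he => by simp [ha.2 e he, hc.2 e he]⟩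
      zero_mem' := ⟨zero_mem _, by simp⟩
      smul_mem' := fun t a ha => ⟨J.smul_mem t ha.1, fun e he => by simp [ha.2 e he]⟩
      lie_mem := fun {x a} ha => ⟨J.lie_mem ha.1, fun e he => by
        rw [← lie_skew, map_neg, LinearMap.neg_apply, traceForm_apply_lie_apply,
          ha.2 _ (J.lie_mem he), neg_zero]⟩ }
  have hmem : ∀ a, a ∈ I ↔ a ∈ J ∧ ∀ c ∈ J, traceForm K g W a c = 0 := fun _ => Iff.rfl
  rcases (hJ.le_iff (x := I)).mp fun a ha => ha.1 with hI | hI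
  · intro a ha
    have : (a : g) ∈ I := (hmem _).mpr ⟨a.2, fun c hc => ha ⟨c, hc⟩⟩
    rw [hI] at this
    exact Subtype.ext (by simpa using this)
  · exfalso
    have h0 : traceForm K J W = 0 := by
      ext a c
      have : (a : g) ∈ I := by rw [hI]; exact a.2
      exact ((hmem _).mp this).2 c c.2
    have hnil := isNilpotent_derivedSeries_of_traceForm_eq_zero h0
    obtain ⟨a, ha, w, hw, haw⟩ := hne
    have hnt : Nontrivial W :=
      ⟨⟨w, hw⟩, 0, fun h => haw (by rw [show w = 0 from congrArg Subtype.val h, lie_zero])⟩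
    have hnt' := nontrivial_max_triv_of_isNilpotent K (LieAlgebra.derivedSeries K J 1) W
    obtain ⟨u, hu⟩ := exists_ne
      (0 : maxTrivSubmodule K (LieAlgebra.derivedSeries K J 1) W)
    let W' : LieSubmodule K g X :=
      { carrier := {w | w ∈ W ∧ ∀ a ∈ J, ⁅a, w⁆ = 0}
        add_mem' := fun ha hc => ⟨add_mem ha.1 hc.1, fun e he => by simp [ha.2 e he, hc.2 e he]⟩
        zero_mem' := ⟨zero_mem _, by simp⟩
        smul_mem' := fun t a ha => ⟨W.smul_mem t ha.1, fun e he => by simp [ha.2 e he]⟩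
        lie_mem := fun {x w} hw => ⟨W.lie_mem hw.1, fun e he => by
          have : ⁅e, x⁆ ∈ J := by rw [← lie_skew]; exact neg_mem (J.lie_mem he)
          rw [leibniz_lie, hw.2 _ this, hw.2 _ he, lie_zero, add_zero]⟩ }
    have hmem' : ∀ w, w ∈ W' ↔ w ∈ W ∧ ∀ a ∈ J, ⁅a, w⁆ = 0 := fun _ => Iff.rfl
    have huW' : (u : W).1 ∈ W' := by
      refine (hmem' _).mpr ⟨u.1.2, fun c hc => ?_⟩
      have h1 : (⟨c, hc⟩ : J) ∈ LieAlgebra.derivedSeries K J 1 := by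
        rw [derivedSeries_one_of_isAtom hJ]; trivial
      have h2 := u.2 ⟨_, h1⟩
      exact congrArg Subtype.val h2
    rcases hW W' fun w hw => hw.1 with h | h
    · rw [h] at huW'
      exact hu (Subtype.ext (Subtype.ext (by simpa using huW')))
    · rw [← h] at hw
      exact haw (hw.2 a ha)

variable [FiniteDimensional K g]

/-- The inductive step in the vanishing of the first cohomology: the irreducible case. -/
lemma exists_sub_mem_maxTrivSubmodule_of_irreducible (W : LieSubmodule K g X)
    [FiniteDimensional K W] (hW : ∀ W' ≤ W, W' = ⊥ ∨ W' = W) (v : X) (hv : ∀ x : g, ⁅x, v⁆ ∈ W) :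
    ∃ w ∈ W, v - w ∈ maxTrivSubmodule K g X := by
  by_cases hne : ∃ J : LieIdeal K g, IsAtom J ∧ ∃ a ∈ J, ∃ w ∈ W, ⁅a, w⁆ ≠ 0
  · obtain ⟨J, hJ, hne⟩ := hne
    have hB := traceForm_nondegenerate_of_isAtom W hW hJ hne
    have hs : LinearMap.BilinForm.IsSymm (traceForm K J W) := ⟨traceForm_comm K J W⟩
    have hinv : ∀ (x : g) (a c : J),
        traceForm K J W ⁅x, a⁆ c = - traceForm K J W a ⁅x, c⁆ := fun x a c => by
      change traceForm K g W ⁅x, (a : g)⁆ c = - traceForm K g W a ⁅x, (c : g)⁆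
      rw [← lie_skew, map_neg, LinearMap.neg_apply, traceForm_apply_lie_apply]
    classical
    let b := Module.finBasis K J
    set d := (traceForm K J W).dualBasis hB b
    have hcoe : ∀ w : W, (casimir b d W w : X) = casimir b d X (w : X) := fun w => by
      simp [casimir_apply]
    have hcomm : ∀ (x : g) (u : X), casimir b d X ⁅x, u⁆ = ⁅x, casimir b d X u⁆ :=
      casimir_lie _ hB hs hinv b
    -- Each summand has trace `B (b i) (d i) = 1`. In characteristic zero the trace is thus nonzero,
    -- so the Casimir operator is nonzero on `W`; its kernel is a `g`-submodule, so it is injective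
    -- there.
    have htr : LinearMap.trace K W (casimir b d W) = (finrank K J : K) := by
      have h1 : ∀ i, LinearMap.trace K W (toEnd K g W (b i : g) * toEnd K g W (d i : g)) = 1 :=
        fun i => by
          have := LinearMap.BilinForm.apply_dualBasis_right hB hs b i i
          rw [if_pos rfl] at this
          exact this
      simp [casimir, h1]
    have hJ0 : finrank K J ≠ 0 := by
      intro h0
      apply hJ.1
      rw [← LieSubmodule.toSubmodule_eq_bot]
      exact Submodule.finrank_eq_zero.mp h0
    let W' : LieSubmodule K g X :=
      { carrier := {w | w ∈ W ∧ casimir b d X w = 0}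
        add_mem' := fun ha hc => ⟨add_mem ha.1 hc.1, by simp [ha.2, hc.2]⟩
        zero_mem' := ⟨zero_mem _, by simp⟩
        smul_mem' := fun t a ha => ⟨W.smul_mem t ha.1, by simp [ha.2]⟩
        lie_mem := fun {x w} hw => ⟨W.lie_mem hw.1, by rw [hcomm, hw.2, lie_zero]⟩ }
    have hbot : W' = ⊥ := by
      refine (hW W' fun w hw => hw.1).resolve_right fun h => hJ0 ?_
      have hc0 : casimir b d W = 0 := by
        refine LinearMap.ext fun w => Subtype.ext ?_
        have hw : (w : X) ∈ W' := by rw [h]; exact w.2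
        rw [hcoe, hw.2]; rfl
      rw [hc0, map_zero] at htr
      exact_mod_cast htr.symm
    have hinj : Function.Injective (casimir b d W) := by
      rw [injective_iff_map_eq_zero]
      intro w hw
      have : (w : X) ∈ W' := ⟨w.2, by rw [← hcoe, hw]; rfl⟩
      rw [hbot] at this
      exact Subtype.ext (by simpa using this)
    -- The Casimir operator is bijective on `W` and sends `v` into `W`, so some `w` in `W` has the
    -- same image as `v`. Every `⁅x, v - w⁆` then lies in the kernel on `W`, which is zero.
    have hcv : casimir b d X v ∈ W := by
      rw [casimir_apply]
      exact sum_mem fun i _ => W.lie_mem (hv _)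
    obtain ⟨w, hw⟩ := (LinearMap.injective_iff_surjective.mp hinj) ⟨_, hcv⟩
    refine ⟨w, w.2, fun x => ?_⟩
    have hmem : ⁅x, v - (w : X)⁆ ∈ W' := by
      refine ⟨by rw [lie_sub]; exact sub_mem (hv x) (W.lie_mem w.2), ?_⟩
      rw [hcomm, map_sub, ← hcoe, hw, sub_self, lie_zero]
    rw [hbot] at hmem
    simpa using hmem
  -- Here every atom `J` kills `W`, and `J v ⊆ W`, so `J (J v) = 0` and `v` itself is invariant.
  · push Not at hne
    refine ⟨0, zero_mem _, fun x => ?_⟩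
    rw [sub_zero]
    refine lie_eq_zero_of_forall_isAtom (K := K) (fun J hJ => ?_) x
    exact lie_eq_zero_of_lie_lie_eq_zero hJ fun a ha c hc => hne J hJ a ha _ (hv c)

variable (K g) in
/-- Vanishing of the first cohomology of a semisimple Lie algebra with coefficients in a
finite-dimensional module, in elementary form. -/
theorem exists_sub_mem_maxTrivSubmodule (n : ℕ) :
    ∀ (X : Type w) [AddCommGroup X] [Module K X] [LieRingModule g X] [LieModule K g X]
      (W : LieSubmodule K g X) [FiniteDimensional K W] (_ : finrank K W = n) (v : X)
      (_ : ∀ x : g, ⁅x, v⁆ ∈ W), ∃ w ∈ W, v - w ∈ maxTrivSubmodule K g X := by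
  induction n using Nat.strong_induction_on with
  | _ n ih =>
  intro X _ _ _ _ W _ hn v hv
  by_cases hW : ∀ W' ≤ W, W' = ⊥ ∨ W' = W
  · exact exists_sub_mem_maxTrivSubmodule_of_irreducible W hW v hv
  push Not at hW
  obtain ⟨W', hle, hbot, hne⟩ := hW
  have hlt : W'.toSubmodule < W.toSubmodule :=
    lt_of_le_of_ne hle fun h => hne (LieSubmodule.toSubmodule_injective h)
  have : FiniteDimensional K W' := Submodule.finiteDimensional_of_le hle
  let f := LieSubmodule.Quotient.mk' W'
  have hfd : FiniteDimensional K (W.map f) :=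
    inferInstanceAs (FiniteDimensional K (W.toSubmodule.map (f : X →ₗ[K] X ⧸ W')))
  have hrk : finrank K (W.map f) < n := by
    rw [← hn]
    let h := (f : X →ₗ[K] X ⧸ W').domRestrict W.toSubmodule
    have h1 := h.finrank_range_add_finrank_ker
    have h2 : LinearMap.range h = W.toSubmodule.map (f : X →ₗ[K] X ⧸ W') :=
      LinearMap.range_domRestrict _ _
    have h3 : finrank K (LinearMap.ker h) ≠ 0 := fun h0 => by
      apply hbot
      rw [LieSubmodule.eq_bot_iff]
      intro u hu
      have : (⟨u, hle hu⟩ : W.toSubmodule) ∈ LinearMap.ker h := by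
        rw [LinearMap.mem_ker]
        exact (LieSubmodule.Quotient.mk_eq_zero W').mpr hu
      rw [Submodule.finrank_eq_zero.mp h0] at this
      exact congrArg Subtype.val ((Submodule.mem_bot K).mp this)
    rw [h2] at h1
    change finrank K (W.toSubmodule.map (f : X →ₗ[K] X ⧸ W')) < finrank K W.toSubmodule
    omega
  -- Correct `v` modulo `W'` first; the remaining obstruction takes values in `W'`, where induction
  -- applies again.
  obtain ⟨w, hw, hvw⟩ := ih _ hrk (X ⧸ W') (W.map f) rfl (f v) fun x => by
    rw [← LieModuleHom.map_lie]
    exact LieSubmodule.mem_map_of_mem (hv x)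
  obtain ⟨w, hwW, rfl⟩ := (LieSubmodule.mem_map _).mp hw
  have hlt' : finrank K W' < n := hn ▸ Submodule.finrank_lt_finrank_of_lt hlt
  obtain ⟨u, hu, hvu⟩ := ih _ hlt' X W' rfl (v - w) fun x => by
    have := hvw x
    rwa [← map_sub, ← LieModuleHom.map_lie, LieSubmodule.Quotient.mk_eq_zero] at this
  exact ⟨w + u, add_mem hwW (hle hu), by rwa [← sub_sub]⟩

/-- Every submodule of a finite-dimensional module over a semisimple Lie algebra is a retract. -/
theorem exists_retraction [FiniteDimensional K X] (N : LieSubmodule K g X) :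
    ∃ r : X →ₗ⁅K,g⁆ N, ∀ y : N, r y = y := by
  -- Maps vanishing on `N`. A linear projection `p` onto `N` restricts to the equivariant identity
  -- on `N`, so every `⁅x, p⁆` lies in `W`; subtracting an element of `W` makes `p` equivariant and
  -- keeps it a projection.
  let W : LieSubmodule K g (X →ₗ[K] N) :=
    { carrier := {h | ∀ y : N, h y = 0}
      add_mem' := fun ha hc y => by simp [ha y, hc y]
      zero_mem' := fun y => rfl
      smul_mem' := fun t a ha y => by simp [ha y]
      lie_mem := fun {x h} hh y => by
        have := hh ⁅x, y⁆
        rw [LieSubmodule.coe_bracket] at this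
        rw [LieHom.lie_apply, hh y, this, lie_zero, sub_zero] }
  obtain ⟨p, hp⟩ : ∃ p : X →ₗ[K] N, p ∘ₗ N.toSubmodule.subtype = LinearMap.id :=
    LinearMap.exists_leftInverse_of_injective N.toSubmodule.subtype
    N.toSubmodule.ker_subtype
  have hp' : ∀ y : N, p y = y := fun y => LinearMap.congr_fun hp y
  obtain ⟨w, hw, hinv⟩ := exists_sub_mem_maxTrivSubmodule K g _ (X →ₗ[K] N) W rfl p fun x y => by
    have := hp' ⁅x, y⁆
    rw [LieSubmodule.coe_bracket] at this
    rw [LieHom.lie_apply, hp' y, this, sub_self]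
  refine ⟨maxTrivLinearMapEquivLieModuleHom ⟨_, hinv⟩, fun y => ?_⟩
  have : (p - w) y = y := by rw [LinearMap.sub_apply, hp', hw y, sub_zero]
  exact this

/-- Weyl's theorem on complete reducibility. -/
theorem complementedLattice_lieSubmodule [FiniteDimensional K X] :
    ComplementedLattice (LieSubmodule K g X) := by
  refine ⟨fun N => ?_⟩
  obtain ⟨r, hr⟩ := exists_retraction N
  refine ⟨r.ker, ?_⟩
  constructor
  · rw [disjoint_iff, LieSubmodule.eq_bot_iff]
    rintro y ⟨hy, hy'⟩
    have := hr ⟨y, hy⟩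
    rw [LieModuleHom.mem_ker.mp hy'] at this
    exact (congrArg Subtype.val this).symm
  · rw [codisjoint_iff, eq_top_iff]
    intro y _
    rw [LieSubmodule.mem_sup]
    exact ⟨r y, (r y).2, y - r y, by simp [LieModuleHom.mem_ker, hr], by simp⟩

end SemisimpleAlgebra

/-! ### Locally finite modules and the Reynolds splitting -/

section LocallyFinite

variable (K g X : Type*) [Field K] [LieRing g] [AddCommGroup X] [Module K X] [LieRingModule g X]

/-- Every vector lies in a finite-dimensional submodule. -/
def IsLocallyFinite : Prop :=
  ∀ v : X, ∃ F : LieSubmodule K g X, FiniteDimensional K F ∧ v ∈ F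

/-- The linear span `g X` of all `⁅x, m⁆`. -/
def lieRange : Submodule K X := Submodule.span K {m | ∃ (x : g) (b : X), ⁅x, b⁆ = m}

variable {K g X}

lemma lie_mem_lieRange (x : g) (b : X) : ⁅x, b⁆ ∈ lieRange K g X :=
  Submodule.subset_span ⟨x, b, rfl⟩

variable {Y : Type*} [AddCommGroup Y] [Module K Y] [LieRingModule g Y]

lemma map_mem_lieRange (f : X →ₗ⁅K,g⁆ Y) {m : X} (hm : m ∈ lieRange K g X) :
    f m ∈ lieRange K g Y := by
  have : lieRange K g X ≤ (lieRange K g Y).comap (f : X →ₗ[K] Y) := by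
    rw [lieRange, Submodule.span_le]
    rintro _ ⟨x, b, rfl⟩
    simpa using lie_mem_lieRange x (f b)
  exact this hm

lemma IsLocallyFinite.of_surjective (h : IsLocallyFinite K g X) (f : X →ₗ⁅K,g⁆ Y)
    (hf : Function.Surjective f) : IsLocallyFinite K g Y := fun y => by
  obtain ⟨v, rfl⟩ := hf y
  obtain ⟨F, hF, hv⟩ := h v
  exact ⟨F.map f, inferInstanceAs (FiniteDimensional K (F.toSubmodule.map (f : X →ₗ[K] Y))),
    LieSubmodule.mem_map_of_mem hv⟩

lemma IsLocallyFinite.of_injective (h : IsLocallyFinite K g Y) (f : X →ₗ⁅K,g⁆ Y)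
    (hf : Function.Injective f) : IsLocallyFinite K g X := fun x => by
  obtain ⟨F, hF, hx⟩ := h (f x)
  have : FiniteDimensional K F.toSubmodule := hF
  let e : F.comap f →ₗ[K] F.toSubmodule := ((f : X →ₗ[K] Y).domRestrict _).codRestrict _ fun y => y.2
  exact ⟨F.comap f, FiniteDimensional.of_injective e fun y z hyz =>
    Subtype.ext (hf (congrArg Subtype.val hyz)), hx⟩

lemma exists_finiteDimensional_forall_mem (h : IsLocallyFinite K g X) {ι : Type*} (s : Finset ι)
    (v : ι → X) : ∃ F : LieSubmodule K g X, FiniteDimensional K F ∧ ∀ i ∈ s, v i ∈ F := by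
  classical
  induction s using Finset.induction_on with
  | empty => exact ⟨⊥, inferInstanceAs (FiniteDimensional K (⊥ : Submodule K X)), by simp⟩
  | insert a s _ ih =>
    obtain ⟨F, hF, hs⟩ := ih
    obtain ⟨F', hF', ha⟩ := h (v a)
    refine ⟨F ⊔ F', ?_, fun i hi => ?_⟩
    · change FiniteDimensional K ((F ⊔ F' : LieSubmodule K g X).toSubmodule)
      rw [LieSubmodule.sup_toSubmodule]
      infer_instance
    · rcases Finset.mem_insert.mp hi with rfl | hi
      · exact (le_sup_right : F' ≤ F ⊔ F') ha
      · exact (le_sup_left : F ≤ F ⊔ F') (hs i hi)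

variable [LieAlgebra K g] [LieModule K g X]

/-- The values on a basis of `Y` lie in one finite-dimensional submodule `F`, and the maps into `F`
form a finite-dimensional `g`-submodule. -/
lemma IsLocallyFinite.linearMap (h : IsLocallyFinite K g X) [LieModule K g Y] [FiniteDimensional K Y] :
    IsLocallyFinite K g (Y →ₗ[K] X) := fun f => by
  let b := Module.finBasis K Y
  obtain ⟨F, hF, hb⟩ := exists_finiteDimensional_forall_mem h Finset.univ fun i => f (b i)
  let H : LieSubmodule K g (Y →ₗ[K] X) :=
    { carrier := {f | ∀ y, f y ∈ F}
      add_mem' := fun ha hc y => add_mem (ha y) (hc y)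
      zero_mem' := fun y => zero_mem _
      smul_mem' := fun t a ha y => F.smul_mem t (ha y)
      lie_mem := fun {x h} hh y => by
        rw [LieHom.lie_apply]
        exact sub_mem (F.lie_mem (hh y)) (hh _) }
  refine ⟨H, ?_, fun y => ?_⟩
  · let e : H →ₗ[K] (Y →ₗ[K] F.toSubmodule) :=
      { toFun := fun f => (f : Y →ₗ[K] X).codRestrict F.toSubmodule f.2
        map_add' := fun _ _ => rfl
        map_smul' := fun _ _ => rfl }
    have : FiniteDimensional K F.toSubmodule := hF
    refine FiniteDimensional.of_injective e fun f f' hff => ?_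
    ext y
    exact congrArg Subtype.val (LinearMap.congr_fun hff y)
  · have : f y = ∑ i, b.repr y i • f (b i) := by
      conv_lhs => rw [← b.sum_repr y, map_sum]
      simp_rw [map_smul]
    rw [this]
    exact sum_mem fun i hi => F.smul_mem _ (hb i hi)

variable [CharZero K] [FiniteDimensional K g] [LieAlgebra.IsSemisimple K g]

/-- For `F` finite-dimensional containing `v`, the brackets `⁅x, v⁆` lie in the submodule `F ∩ gX`;
vanishing of cohomology there makes `v` invariant after a correction from `gX`. -/
lemma exists_add_eq (h : IsLocallyFinite K g X) (v : X) :
    ∃ s ∈ maxTrivSubmodule K g X, ∃ t ∈ lieRange K g X, s + t = v := by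
  obtain ⟨F, hF, hv⟩ := h v
  let W : LieSubmodule K g X :=
    { __ := F.toSubmodule ⊓ lieRange K g X
      lie_mem := fun {x m} hm => ⟨F.lie_mem hm.1, lie_mem_lieRange x m⟩ }
  have : FiniteDimensional K W := Submodule.finiteDimensional_of_le
    (inf_le_left : F.toSubmodule ⊓ lieRange K g X ≤ F.toSubmodule)
  obtain ⟨w, hw, hvw⟩ := exists_sub_mem_maxTrivSubmodule K g _ X W rfl v fun x =>
    ⟨F.lie_mem hv, lie_mem_lieRange x v⟩
  exact ⟨v - w, hvw, w, hw.2, sub_add_cancel v w⟩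

/-- The sum of brackets giving `u` already exists in a finite-dimensional submodule `F`. An
equivariant retraction of `F` onto the line through `u` fixes `u`, but sends `gF` to `g` times a
trivial module, which is zero. -/
lemma eq_zero_of_mem_lieRange (h : IsLocallyFinite K g X) {u : X}
    (hu : u ∈ maxTrivSubmodule K g X) (hu' : u ∈ lieRange K g X) : u = 0 := by
  obtain ⟨F, hF, v, rfl, hv⟩ : ∃ F : LieSubmodule K g X, FiniteDimensional K F ∧
      ∃ v : F, (v : X) = u ∧ v ∈ lieRange K g F := by
    clear hu
    induction hu' using Submodule.span_induction with
    | mem m hm =>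
      obtain ⟨x, b, rfl⟩ := hm
      obtain ⟨F, hF, hb⟩ := h b
      exact ⟨F, hF, ⁅x, ⟨b, hb⟩⁆, rfl, lie_mem_lieRange _ _⟩
    | zero => exact ⟨⊥, inferInstanceAs (FiniteDimensional K (⊥ : Submodule K X)), 0, rfl, zero_mem _⟩
    | add a c _ _ ha hc =>
      obtain ⟨F, hF, a, rfl, ha⟩ := ha
      obtain ⟨F', hF', c, rfl, hc⟩ := hc
      have hfd : FiniteDimensional K (F ⊔ F' : LieSubmodule K g X) := by
        change FiniteDimensional K ((F ⊔ F' : LieSubmodule K g X).toSubmodule)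
        rw [LieSubmodule.sup_toSubmodule]
        infer_instance
      exact ⟨F ⊔ F', hfd, LieSubmodule.inclusion le_sup_left a +
        LieSubmodule.inclusion le_sup_right c, rfl,
        add_mem (map_mem_lieRange _ ha) (map_mem_lieRange _ hc)⟩
    | smul t a _ ha =>
      obtain ⟨F, hF, a, rfl, ha⟩ := ha
      exact ⟨F, hF, t • a, rfl, Submodule.smul_mem _ t ha⟩
  have hinv : ∀ x : g, ⁅x, v⁆ = 0 := fun x => Subtype.ext (hu x)
  let N : LieSubmodule K g F :=
    { __ := Submodule.span K {v}
      lie_mem := fun {x m} hm => by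
        obtain ⟨t, rfl⟩ := Submodule.mem_span_singleton.mp hm
        rw [lie_smul, hinv, smul_zero]
        exact Submodule.zero_mem _ }
  obtain ⟨r, hr⟩ := exists_retraction N
  have hN : lieRange K g N = ⊥ := by
    rw [lieRange, Submodule.span_eq_bot]
    rintro _ ⟨x, ⟨m, hm⟩, rfl⟩
    obtain ⟨t, rfl⟩ := Submodule.mem_span_singleton.mp hm
    refine Subtype.ext ?_
    change ⁅x, t • v⁆ = 0
    rw [lie_smul, hinv, smul_zero]
  have h1 := map_mem_lieRange r hv
  rw [hN, Submodule.mem_bot] at h1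
  have h2 := hr ⟨v, Submodule.mem_span_singleton_self v⟩
  rw [h1] at h2
  have h3 : (0 : F) = v := congrArg Subtype.val h2
  rw [← h3]
  rfl

lemma sSup_isAtom_eq_top (h : IsLocallyFinite K g X) :
    sSup {N : LieSubmodule K g X | IsAtom N} = ⊤ := by
  rw [eq_top_iff]
  intro v _
  obtain ⟨F, hF, hv⟩ := h v
  have hcl : ComplementedLattice (LieSubmodule K g F) := complementedLattice_lieSubmodule
  have := isAtomistic_of_complementedLattice (α := LieSubmodule K g F)
  have htop : (⟨v, hv⟩ : F) ∈ (sSup {N | IsAtom N} : LieSubmodule K g F) := by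
    rw [sSup_atoms_eq_top]; trivial
  have hle : (sSup {N | IsAtom N} : LieSubmodule K g F) ≤
      (sSup {N : LieSubmodule K g X | IsAtom N}).comap F.incl := by
    refine sSup_le fun N hN => ?_
    rw [← LieSubmodule.map_le_iff_le_comap]
    refine le_sSup ⟨?_, fun N' hN' => ?_⟩
    · intro h0
      refine hN.1 ((LieSubmodule.eq_bot_iff _).mpr fun m hm => ?_)
      have : F.incl m ∈ N.map F.incl := LieSubmodule.mem_map_of_mem hm
      rw [h0] at this
      exact Subtype.ext (by simpa using this)
    · have hNF : N'.comap F.incl < N := by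
        refine lt_of_le_of_ne (fun m hm => ?_) fun heq => hN'.not_ge ?_
        · obtain ⟨m', hm', h'⟩ := (LieSubmodule.mem_map _).mp (hN'.le hm)
          rwa [← Subtype.ext h']
        · rw [LieSubmodule.map_le_iff_le_comap, heq]
      have hb := hN.2 _ hNF
      refine (LieSubmodule.eq_bot_iff _).mpr fun m hm => ?_
      obtain ⟨m', -, rfl⟩ := (LieSubmodule.mem_map _).mp (hN'.le hm)
      have : m' ∈ N'.comap F.incl := hm
      rw [hb] at this
      rw [(LieSubmodule.mem_bot _).mp this, map_zero]
  exact hle htop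

end LocallyFinite

end LieModule

noncomputable section

namespace GenTakiff

universe u v w

attribute [local instance 100] LieRing.ofAssociativeRing

open UniversalEnvelopingAlgebra LieModule

/-! ### Universal enveloping algebras and their action -/

section UniversalEnveloping

variable {L : Type u} [LieRing L] [LieAlgebra ℂ L]

/-- The map `U(L) → S` from the universal property, followed by the inclusion of `S`, is the
identity. This serves as the induction principle for `U(L)`. -/
lemma subalgebra_eq_top (S : Subalgebra ℂ (U L)) (h : ∀ x : L, ι ℂ x ∈ S) : S = ⊤ := by
  let f : L →ₗ⁅ℂ⁆ S :=
    { toFun := fun x => ⟨ι ℂ x, h x⟩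
      map_add' := fun x y => Subtype.ext (map_add _ _ _)
      map_smul' := fun t x => Subtype.ext (map_smul _ _ _)
      map_lie' := fun {x y} => Subtype.ext (LieHom.map_lie _ _ _) }
  have hid : S.val.comp (UniversalEnvelopingAlgebra.lift ℂ f) = AlgHom.id ℂ (U L) := by
    refine UniversalEnvelopingAlgebra.hom_ext (R := ℂ) (LieHom.ext fun x => ?_)
    change S.val (UniversalEnvelopingAlgebra.lift ℂ f (ι ℂ x)) = ι ℂ x
    rw [UniversalEnvelopingAlgebra.lift_ι_apply]
    rfl
  rw [eq_top_iff]
  intro u _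
  have := AlgHom.congr_fun hid u
  rw [AlgHom.id_apply] at this
  rw [← this]
  exact (UniversalEnvelopingAlgebra.lift ℂ f u).2

lemma adjoin_range_ι : Algebra.adjoin ℂ (Set.range (ι ℂ : L → U L)) = ⊤ :=
  subalgebra_eq_top _ fun x => Algebra.subset_adjoin ⟨x, rfl⟩

variable {W : Type v} [AddCommGroup W] [Module ℂ W] [LieRingModule L W] [LieModule ℂ L W]
  {W' : Type w} [AddCommGroup W'] [Module ℂ W'] [LieRingModule L W'] [LieModule ℂ L W']

lemma uAct_ι (x : L) (m : W) : uAct L W (ι ℂ x) m = ⁅x, m⁆ := by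
  rw [uAct, UniversalEnvelopingAlgebra.lift_ι_apply, toEnd_apply_apply]

lemma uAct_mem (N : LieSubmodule ℂ L W) (a : U L) {m : W} (hm : m ∈ N) : uAct L W a m ∈ N := by
  let S : Subalgebra ℂ (U L) :=
    { carrier := {a | ∀ m ∈ N, uAct L W a m ∈ N}
      mul_mem' := fun {a b} ha hb m hm => by
        rw [map_mul, Module.End.mul_apply]; exact ha _ (hb _ hm)
      add_mem' := fun {a b} ha hb m hm => by
        rw [map_add, LinearMap.add_apply]; exact add_mem (ha _ hm) (hb _ hm)
      algebraMap_mem' := fun t m hm => by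
        rw [AlgHom.commutes, Module.algebraMap_end_apply]; exact N.smul_mem t hm }
  have hS : S = ⊤ := subalgebra_eq_top S fun x m hm => by rw [uAct_ι]; exact N.lie_mem hm
  have ha : a ∈ S := by rw [hS]; trivial
  exact ha m hm

lemma uAct_map (f : W →ₗ⁅ℂ,L⁆ W') (a : U L) (m : W) : f (uAct L W a m) = uAct L W' a (f m) := by
  let S : Subalgebra ℂ (U L) :=
    { carrier := {a | ∀ m, f (uAct L W a m) = uAct L W' a (f m)}
      mul_mem' := fun {a b} ha hb m => by
        rw [map_mul, map_mul, Module.End.mul_apply, Module.End.mul_apply, ha, hb]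
      add_mem' := fun {a b} ha hb m => by
        rw [map_add, map_add, LinearMap.add_apply, LinearMap.add_apply, map_add, ha, hb]
      algebraMap_mem' := fun t m => by
        rw [AlgHom.commutes, AlgHom.commutes, Module.algebraMap_end_apply,
          Module.algebraMap_end_apply, map_smul] }
  have hS : S = ⊤ := subalgebra_eq_top S fun x m => by rw [uAct_ι, uAct_ι, LieModuleHom.map_lie]
  have ha : a ∈ S := by rw [hS]; trivial
  exact ha m

lemma HasRadCentralChar.of_surjective {χ : RadCentralChar L} (h : HasRadCentralChar χ W)
    (f : W →ₗ⁅ℂ,L⁆ W') (hf : Function.Surjective f) : HasRadCentralChar χ W' := fun z m => by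
  obtain ⟨m, rfl⟩ := hf m
  rw [← uAct_map, h, map_smul]

end UniversalEnveloping

/-! ### The image of `U(r)` under the adjoint action -/

section RadicalAlgebra

variable (L : Type u) [LieRing L] [LieAlgebra ℂ L]

/-- The image of `U(r)` in `U(L)`. -/
def radAlg : Subalgebra ℂ (U L) := (uRadIncl L).range

variable {L}

lemma uRadIncl_ι (y : LieAlgebra.radical ℂ L) : uRadIncl L (ι ℂ y) = ι ℂ (y : L) := by
  rw [uRadIncl, UniversalEnvelopingAlgebra.lift_ι_apply]
  rfl

lemma radAlg_eq_adjoin :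
    radAlg L = Algebra.adjoin ℂ (ι ℂ '' (LieAlgebra.radical ℂ L : Set L)) := by
  rw [radAlg, ← Algebra.map_top, ← adjoin_range_ι, AlgHom.map_adjoin, ← Set.range_comp]
  congr 1
  ext a
  constructor
  · rintro ⟨y, rfl⟩
    exact ⟨(y : L), y.2, (uRadIncl_ι y).symm⟩
  · rintro ⟨y, hy, rfl⟩
    exact ⟨⟨y, hy⟩, uRadIncl_ι _⟩

lemma ι_mem_radAlg {y : L} (hy : y ∈ LieAlgebra.radical ℂ L) : ι ℂ y ∈ radAlg L := by
  rw [radAlg_eq_adjoin]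
  exact Algebra.subset_adjoin ⟨y, hy, rfl⟩

lemma ι_mul_sub (x y : L) : ι ℂ x * ι ℂ y - ι ℂ y * ι ℂ x = ι ℂ ⁅x, y⁆ := by
  rw [LieHom.map_lie, LieRing.of_associative_ring_bracket]

/-- The ideal `r` itself is stable, and sums and products of finite-dimensional stable subspaces are
again such, by the Leibniz rule. -/
lemma exists_commutator_stable [FiniteDimensional ℂ L] {a : U L} (ha : a ∈ radAlg L) :
    ∃ F : Submodule ℂ (U L), FiniteDimensional ℂ F ∧ F ≤ (radAlg L).toSubmodule ∧ a ∈ F ∧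
      ∀ (x : L), ∀ b ∈ F, ι ℂ x * b - b * ι ℂ x ∈ F := by
  rw [radAlg_eq_adjoin] at ha
  induction ha using Algebra.adjoin_induction with
  | mem a ha =>
    obtain ⟨y, hy, rfl⟩ := ha
    refine ⟨(LieAlgebra.radical ℂ L).toSubmodule.map (ι ℂ : L →ₗ⁅ℂ⁆ U L).toLinearMap, inferInstance, ?_,
      ⟨y, hy, rfl⟩, ?_⟩
    · rintro _ ⟨z, hz, rfl⟩
      exact ι_mem_radAlg hz
    · rintro x _ ⟨z, hz, rfl⟩
      exact ⟨⁅x, z⁆, (LieAlgebra.radical ℂ L).lie_mem hz, (ι_mul_sub x z).symm⟩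
  | algebraMap t =>
    refine ⟨Submodule.span ℂ {1}, inferInstance, ?_, ?_, fun x b hb => ?_⟩
    · rw [Submodule.span_le, Set.singleton_subset_iff]
      exact one_mem (radAlg L)
    · rw [Algebra.algebraMap_eq_smul_one]
      exact Submodule.smul_mem _ _ (Submodule.mem_span_singleton_self _)
    · obtain ⟨t, rfl⟩ := Submodule.mem_span_singleton.mp hb
      simp
  | add a b _ _ ha hb =>
    obtain ⟨F, hF, hle, haF, hst⟩ := ha
    obtain ⟨F', hF', hle', hbF, hst'⟩ := hb
    refine ⟨F ⊔ F', inferInstance, sup_le hle hle', add_mem (Submodule.mem_sup_left haF)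
      (Submodule.mem_sup_right hbF), fun x c hc => ?_⟩
    obtain ⟨c, hc', d, hd, rfl⟩ := Submodule.mem_sup.mp hc
    rw [mul_add, add_mul, add_sub_add_comm]
    exact add_mem (Submodule.mem_sup_left (hst x c hc')) (Submodule.mem_sup_right (hst' x d hd))
  | mul a b _ _ ha hb =>
    obtain ⟨F, hF, hle, haF, hst⟩ := ha
    obtain ⟨F', hF', hle', hbF, hst'⟩ := hb
    refine ⟨F * F', ?_, ?_, Submodule.mul_mem_mul haF hbF, fun x c hc => ?_⟩
    · exact Module.Finite.iff_fg.mpr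
        ((Module.Finite.iff_fg.mp hF).mul (Module.Finite.iff_fg.mp hF'))
    · exact Submodule.mul_le.mpr fun c hc d hd => mul_mem (S := Subalgebra ℂ (U L)) (hle hc) (hle' hd)
    · induction hc using Submodule.mul_induction_on' with
      | mem_mul_mem c hc d hd =>
        have : ι ℂ x * (c * d) - c * d * ι ℂ x =
            (ι ℂ x * c - c * ι ℂ x) * d + c * (ι ℂ x * d - d * ι ℂ x) := by noncomm_ring
        rw [this]
        exact add_mem (Submodule.mul_mem_mul (hst x c hc) hd)
          (Submodule.mul_mem_mul hc (hst' x d hd))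
      | add c _ d _ hc hd =>
        rw [mul_add, add_mul, add_sub_add_comm]
        exact add_mem hc hd

lemma commutator_mem_radAlg (x : L) {a : U L} (ha : a ∈ radAlg L) :
    ι ℂ x * a - a * ι ℂ x ∈ radAlg L := by
  rw [radAlg_eq_adjoin] at ha
  induction ha using Algebra.adjoin_induction with
  | mem a ha =>
    obtain ⟨y, hy, rfl⟩ := ha
    rw [ι_mul_sub]
    exact ι_mem_radAlg ((LieAlgebra.radical ℂ L).lie_mem hy)
  | algebraMap t => rw [Algebra.commutes, sub_self]; exact zero_mem _
  | add a b _ _ ha hb =>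
    rw [mul_add, add_mul, add_sub_add_comm]
    exact add_mem ha hb
  | mul a b ha' hb' ha hb =>
    rw [← radAlg_eq_adjoin] at ha' hb'
    have : ι ℂ x * (a * b) - a * b * ι ℂ x =
        (ι ℂ x * a - a * ι ℂ x) * b + a * (ι ℂ x * b - b * ι ℂ x) := by noncomm_ring
    rw [this]
    exact add_mem (mul_mem ha hb') (mul_mem ha' hb)

/-- The adjoint action of `L` on the image of `U(r)`. -/
instance : LieRingModule L (radAlg L) where
  bracket x a := ⟨ι ℂ x * a - a * ι ℂ x, commutator_mem_radAlg x a.2⟩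
  add_lie x y a := Subtype.ext <| by
    change ι ℂ (x + y) * (a : U L) - a * ι ℂ (x + y) = (ι ℂ x * a - a * ι ℂ x) +
      (ι ℂ y * a - a * ι ℂ y)
    rw [map_add]; noncomm_ring
  lie_add x a b := Subtype.ext <| by
    change ι ℂ x * ((a : U L) + b) - (a + b) * ι ℂ x = (ι ℂ x * a - a * ι ℂ x) +
      (ι ℂ x * b - b * ι ℂ x)
    noncomm_ring
  leibniz_lie x y a := Subtype.ext <| by
    change ι ℂ x * (ι ℂ y * (a : U L) - a * ι ℂ y) - (ι ℂ y * a - a * ι ℂ y) * ι ℂ x =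
      (ι ℂ ⁅x, y⁆ * a - a * ι ℂ ⁅x, y⁆) +
      (ι ℂ y * (ι ℂ x * a - a * ι ℂ x) - (ι ℂ x * a - a * ι ℂ x) * ι ℂ y)
    rw [← ι_mul_sub]; noncomm_ring

instance : LieModule ℂ L (radAlg L) where
  smul_lie t x a := Subtype.ext <| by
    change ι ℂ (t • x) * (a : U L) - a * ι ℂ (t • x) = t • (ι ℂ x * (a : U L) - a * ι ℂ x)
    rw [map_smul, smul_mul_assoc, mul_smul_comm, smul_sub]
  lie_smul t x a := Subtype.ext <| by
    change ι ℂ x * (t • (a : U L)) - (t • (a : U L)) * ι ℂ x = t • (ι ℂ x * (a : U L) - a * ι ℂ x)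
    rw [smul_mul_assoc, mul_smul_comm, smul_sub]

lemma isLocallyFinite_radAlg [FiniteDimensional ℂ L] (g : LieSubalgebra ℂ L) :
    IsLocallyFinite ℂ g (radAlg L) := fun a => by
  obtain ⟨F, hF, hle, haF, hst⟩ := exists_commutator_stable a.2
  refine ⟨{ __ := F.comap (radAlg L).toSubmodule.subtype
            lie_mem := fun {x b} hb => hst x _ hb }, ?_, haF⟩
  let e : F.comap (radAlg L).toSubmodule.subtype →ₗ[ℂ] F :=
    ((radAlg L).toSubmodule.subtype.domRestrict _).codRestrict F fun b => b.2
  exact FiniteDimensional.of_injective e fun b c hbc =>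
    Subtype.ext (Subtype.ext (congrArg (Subtype.val : F → U L) hbc))

section Abelian

variable (hab : IsLieAbelian (LieAlgebra.radical ℂ L))

include hab

lemma ι_commute {x y : L} (hx : x ∈ LieAlgebra.radical ℂ L) (hy : y ∈ LieAlgebra.radical ℂ L) :
    ι ℂ x * ι ℂ y = ι ℂ y * ι ℂ x := by
  have h : ⁅x, y⁆ = 0 := congrArg Subtype.val (hab.trivial ⟨x, hx⟩ ⟨y, hy⟩)
  rw [← sub_eq_zero, ι_mul_sub, h, map_zero]

lemma radAlg_mul_comm {a b : U L} (ha : a ∈ radAlg L) (hb : b ∈ radAlg L) : a * b = b * a := by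
  rw [radAlg_eq_adjoin] at ha hb
  have := Algebra.isMulCommutative_adjoin ℂ (s := ι ℂ '' (LieAlgebra.radical ℂ L : Set L)) <| by
    rintro _ ⟨x, hx, rfl⟩ _ ⟨y, hy, rfl⟩
    exact ι_commute hab hx hy
  exact congrArg Subtype.val (this.is_comm.comm ⟨a, ha⟩ ⟨b, hb⟩)

lemma isNoetherianRing_radAlg [FiniteDimensional ℂ L] : IsNoetherianRing (radAlg L) := by
  obtain ⟨s, hs⟩ : (LieAlgebra.radical ℂ L).toSubmodule.FG := IsNoetherian.noetherian _
  have hfg : (radAlg L).FG := by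
    classical
    refine ⟨s.image (ι ℂ), ?_⟩
    have h1 : (ι ℂ '' (LieAlgebra.radical ℂ L : Set L) : Set (U L)) =
        Submodule.span ℂ ((s.image (ι ℂ) : Finset (U L)) : Set (U L)) := by
      have h2 : Submodule.span ℂ (ι ℂ '' (s : Set L)) =
          (LieAlgebra.radical ℂ L).toSubmodule.map (ι ℂ : L →ₗ⁅ℂ⁆ U L).toLinearMap := by
        rw [← hs, Submodule.map_span]
        rfl
      rw [Finset.coe_image, h2]
      rfl
    rw [radAlg_eq_adjoin, h1, Algebra.adjoin_span]
  have hft : Algebra.FiniteType ℂ (radAlg L) := (Subalgebra.fg_iff_finiteType _).mp hfg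
  let _ : CommRing (radAlg L) :=
    { (inferInstance : Ring (radAlg L)) with
      mul_comm := fun a b => Subtype.ext (radAlg_mul_comm hab a.2 b.2) }
  exact Algebra.FiniteType.isNoetherianRing ℂ (radAlg L)

variable {g : LieSubalgebra ℂ L}
  (hLevi : IsCompl g.toSubmodule (LieAlgebra.radical ℂ L).toSubmodule)

include hLevi

omit hab in
lemma exists_levi (x : L) : ∃ y ∈ g, ∃ z ∈ LieAlgebra.radical ℂ L, y + z = x := by
  have : x ∈ g.toSubmodule ⊔ (LieAlgebra.radical ℂ L).toSubmodule := by
    rw [hLevi.sup_eq_top]; trivial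
  exact Submodule.mem_sup.mp this

/-- Such an `a` commutes with `g` by invariance and with `r` because `U(r)` is commutative; together
these span `L`. -/
lemma mem_radCenter {a : radAlg L} (ha : a ∈ maxTrivSubmodule ℂ g (radAlg L)) :
    (a : U L) ∈ radCenter L := by
  refine ⟨Subalgebra.mem_center_iff.mpr fun b => ?_, a.2⟩
  have hS : Subalgebra.centralizer ℂ {(a : U L)} = ⊤ := by
    refine subalgebra_eq_top _ fun x => ?_
    rw [Subalgebra.mem_centralizer_iff]
    rintro _ rfl
    obtain ⟨y, hy, z, hz, rfl⟩ := exists_levi hLevi x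
    have h1 : ι ℂ y * (a : U L) - a * ι ℂ y = 0 := congrArg Subtype.val (ha ⟨y, hy⟩)
    rw [map_add, mul_add, add_mul, sub_eq_zero.mp h1, radAlg_mul_comm hab a.2 (ι_mem_radAlg hz)]
  have hb : b ∈ Subalgebra.centralizer ℂ {(a : U L)} := by rw [hS]; trivial
  exact (Subalgebra.mem_centralizer_iff ℂ |>.mp hb a rfl).symm

end Abelian

end RadicalAlgebra

/-! ### Modules generated by a `g`-invariant vector -/

section Spherical

variable {L : Type u} [LieRing L] [LieAlgebra ℂ L] (g : LieSubalgebra ℂ L)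
  {W : Type v} [AddCommGroup W] [Module ℂ W] [LieRingModule L W] [LieModule ℂ L W]

/-- The vector `w₀` is `g`-invariant and generates the `L`-module `W`, which has radical central
character `χ`. -/
structure IsSphericalVector (χ : RadCentralChar L) (w₀ : W) : Prop where
  lie_eq_zero : ∀ x ∈ g, ⁅x, w₀⁆ = 0
  eq_top : ∀ N : LieSubmodule ℂ L W, w₀ ∈ N → N = ⊤
  hasRadCentralChar : HasRadCentralChar χ W

/-- For a `g`-module homomorphism `f : N → W`, the map `a ↦ a ∘ f` on the image of `U(r)`. -/
def actComp {N : Type w} [AddCommGroup N] [Module ℂ N] [LieRingModule g N] [LieModule ℂ g N]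
    (f : N →ₗ⁅ℂ,g⁆ W) : radAlg L →ₗ⁅ℂ,g⁆ (N →ₗ[ℂ] W) where
  toFun a := (uAct L W (a : U L)).comp (f : N →ₗ[ℂ] W)
  map_add' a b := by ext; simp
  map_smul' t a := by ext; simp
  map_lie' {x a} := by
    ext n
    have h : ((⁅x, a⁆ : radAlg L) : U L) = ι ℂ (x : L) * a - a * ι ℂ (x : L) := rfl
    simp only [LinearMap.comp_apply, LieHom.lie_apply, h, map_sub, map_mul, LinearMap.sub_apply,
      Module.End.mul_apply, uAct_ι, LieModuleHom.coe_toLinearMap, LieModuleHom.map_lie]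
    rfl

lemma actComp_apply {N : Type w} [AddCommGroup N] [Module ℂ N] [LieRingModule g N]
    [LieModule ℂ g N] (f : N →ₗ⁅ℂ,g⁆ W) (a : radAlg L) (n : N) :
    actComp g f a n = uAct L W (a : U L) (f n) := rfl

/-- Acting by the image of `U(r)` on a `g`-invariant vector. -/
def orbitMap {w₀ : W} (h : ∀ x ∈ g, ⁅x, w₀⁆ = 0) : radAlg L →ₗ⁅ℂ,g⁆ W where
  toFun a := uAct L W (a : U L) w₀
  map_add' a b := by simp
  map_smul' t a := by simp
  map_lie' {x a} := by
    have h1 : ((⁅x, a⁆ : radAlg L) : U L) = ι ℂ (x : L) * a - a * ι ℂ (x : L) := rfl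
    have h2 : ⁅(x : L), w₀⁆ = 0 := h x x.2
    simp only [h1, map_sub, map_mul, LinearMap.sub_apply, Module.End.mul_apply, uAct_ι, h2,
      map_zero, sub_zero]
    rfl

variable {g} {χ : RadCentralChar L} {w₀ : W} (hw : IsSphericalVector g χ w₀)
  (hLevi : IsCompl g.toSubmodule (LieAlgebra.radical ℂ L).toSubmodule)

include hw hLevi

/-- The range is stable under `g` by equivariance and under `r` by left multiplication, so it is an
`L`-submodule containing `w₀`. -/
lemma IsSphericalVector.orbitMap_surjective :
    Function.Surjective (orbitMap g hw.lie_eq_zero) := by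
  let N : LieSubmodule ℂ L W :=
    { __ := LinearMap.range (orbitMap g hw.lie_eq_zero : radAlg L →ₗ[ℂ] W)
      lie_mem := by
        rintro x _ ⟨a, rfl⟩
        obtain ⟨y, hy, z, hz, rfl⟩ := exists_levi hLevi x
        rw [add_lie]
        refine Submodule.add_mem _ ⟨⁅(⟨y, hy⟩ : g), a⁆, LieModuleHom.map_lie _ _ _⟩
          ⟨⟨ι ℂ z, ι_mem_radAlg hz⟩ * a, ?_⟩
        change uAct L W (ι ℂ z * (a : U L)) w₀ = ⁅z, uAct L W (a : U L) w₀⁆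
        rw [map_mul, Module.End.mul_apply, uAct_ι] }
  have hN : N = ⊤ := hw.eq_top N ⟨1, by
    change uAct L W (1 : U L) w₀ = w₀
    rw [map_one, Module.End.one_apply]⟩
  intro m
  have hm : m ∈ N := by rw [hN]; trivial
  exact hm

variable [FiniteDimensional ℂ L]

lemma IsSphericalVector.isLocallyFinite : IsLocallyFinite ℂ g W :=
  (isLocallyFinite_radAlg g).of_surjective _ (hw.orbitMap_surjective hLevi)

variable [LieAlgebra.IsSemisimple ℂ g] (hab : IsLieAbelian (LieAlgebra.radical ℂ L))

include hab

/-- Lift `m` to `a = s + t` along the orbit map, with `s` invariant and `t` in the span of brackets.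
Then `s` acts by the scalar `χ s`, while the image of `t` is both invariant and in `gW`, hence zero.
-/
lemma IsSphericalVector.exists_smul_eq {m : W} (hm : m ∈ maxTrivSubmodule ℂ g W) :
    ∃ c : ℂ, m = c • w₀ := by
  obtain ⟨a, rfl⟩ := hw.orbitMap_surjective hLevi m
  obtain ⟨s, hs, t, ht, rfl⟩ := exists_add_eq (isLocallyFinite_radAlg g) a
  have hs' : orbitMap g hw.lie_eq_zero s = χ ⟨s, mem_radCenter hab hLevi hs⟩ • w₀ :=
    hw.hasRadCentralChar ⟨s, mem_radCenter hab hLevi hs⟩ w₀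
  refine ⟨χ ⟨s, mem_radCenter hab hLevi hs⟩, ?_⟩
  have h0 : orbitMap g hw.lie_eq_zero t = 0 := by
    refine eq_zero_of_mem_lieRange (hw.isLocallyFinite hLevi) ?_ (map_mem_lieRange _ ht)
    have : orbitMap g hw.lie_eq_zero t = orbitMap g hw.lie_eq_zero (s + t) -
        orbitMap g hw.lie_eq_zero s := by rw [map_add, add_sub_cancel_left]
    rw [this, hs']
    refine sub_mem hm ((maxTrivSubmodule ℂ g W).smul_mem _ fun x => hw.lie_eq_zero x x.2)
  rw [map_add, h0, hs', add_zero]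

/-- A nonzero invariant of `N` would be a multiple of `w₀` and force `N = ⊤`; so the splitting
leaves `N = gN`. -/
lemma IsSphericalVector.le_lieRange {N : LieSubmodule ℂ L W} (hN : N ≠ ⊤) :
    N.toSubmodule ≤ lieRange ℂ g W := by
  intro n hn
  let f : N →ₗ⁅ℂ,g⁆ W := { N.toSubmodule.subtype with map_lie' := rfl }
  obtain ⟨s, hs, t, ht, hst⟩ := exists_add_eq
    ((hw.isLocallyFinite hLevi).of_injective f Subtype.val_injective) ⟨n, hn⟩
  obtain ⟨c, hc⟩ := hw.exists_smul_eq hLevi hab (m := (s : W)) fun x => congrArg Subtype.val (hs x)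
  have hc0 : c = 0 := by
    by_contra hc0
    refine hN (hw.eq_top N ?_)
    have := N.smul_mem c⁻¹ s.2
    rwa [hc, smul_smul, inv_mul_cancel₀ hc0, one_smul] at this
  have hs0 : s = 0 := Subtype.ext (by rw [hc, hc0, zero_smul]; rfl)
  rw [hs0, zero_add] at hst
  have := map_mem_lieRange f ht
  rwa [hst] at this

lemma IsSphericalVector.sSup_ne_top (h0 : w₀ ≠ 0) :
    sSup {N : LieSubmodule ℂ L W | N ≠ ⊤} ≠ ⊤ := by
  intro htop
  have h1 : w₀ ∈ (sSup {N : LieSubmodule ℂ L W | N ≠ ⊤} : LieSubmodule ℂ L W) := by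
    rw [htop]; trivial
  rw [← LieSubmodule.mem_toSubmodule, LieSubmodule.sSup_toSubmodule] at h1
  have hle : sSup {((s : LieSubmodule ℂ L W) : Submodule ℂ W) | s ∈ {N : LieSubmodule ℂ L W | N ≠ ⊤}}
      ≤ lieRange ℂ g W := by
    refine sSup_le ?_
    rintro _ ⟨N, hN, rfl⟩
    exact hw.le_lieRange hLevi hab hN
  exact h0 (eq_zero_of_mem_lieRange (hw.isLocallyFinite hLevi)
    (fun x => hw.lie_eq_zero x x.2) (hle h1))

/-- Hilbert's finiteness argument. `W` is cyclic over the Noetherian ring `radAlg L`, so finitely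
many homomorphisms generate all of them with coefficients in `radAlg L`. Replacing each coefficient
by its invariant part does not change an equivariant sum, and invariant coefficients act by scalars.
-/
lemma IsSphericalVector.finiteDimensional_hom {N : Type w} [AddCommGroup N] [Module ℂ N]
    [LieRingModule g N] [LieModule ℂ g N] [FiniteDimensional ℂ N] :
    FiniteDimensional ℂ (N →ₗ⁅ℂ,g⁆ W) := by
  classical
  let _ : Module (radAlg L) W :=
    Module.compHom W ((uAct L W).comp (radAlg L).val : radAlg L →ₐ[ℂ] Module.End ℂ W).toRingHom
  have hsmul : ∀ (a : radAlg L) (m : W), a • m = uAct L W (a : U L) m := fun _ _ => rfl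
  have hA := isNoetherianRing_radAlg hab
  have hWn : IsNoetherian (radAlg L) W :=
    isNoetherian_of_surjective (LinearMap.toSpanSingleton (radAlg L) W w₀)
      (LinearMap.range_eq_top.mpr fun m => hw.orbitMap_surjective hLevi m)
  let b := Module.finBasis ℂ N
  let e : (N →ₗ⁅ℂ,g⁆ W) → (Fin (Module.finrank ℂ N) → W) := fun f i => f (b i)
  have hfg : (Submodule.span (radAlg L) (Set.range e)).FG := IsNoetherian.noetherian _
  -- The generators are chosen among the tuples `e f`, so each comes from a `g`-homomorphism `F m`.
  obtain ⟨t, hts, htspan⟩ := (Submodule.fg_span_iff_fg_span_finset_subset _).mp hfg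
  choose! F hF using fun m (hm : m ∈ t) => hts hm
  refine Module.finite_def.mpr ⟨t.image F, ?_⟩
  rw [eq_top_iff]
  intro f _
  have hf : e f ∈ Submodule.span (radAlg L) (t : Set (Fin (Module.finrank ℂ N) → W)) := by
    rw [← htspan]
    exact Submodule.subset_span ⟨f, rfl⟩
  obtain ⟨a, -, ha⟩ := Submodule.mem_span_finset.mp hf
  choose s hs r hr hsr using fun m => exists_add_eq (isLocallyFinite_radAlg g) (a m)
  have hsum : (f : N →ₗ[ℂ] W) = ∑ m ∈ t, actComp g (F m) (a m) := by
    refine b.ext fun i => ?_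
    have h1 := congrFun ha i
    rw [Finset.sum_apply] at h1
    rw [LinearMap.sum_apply]
    refine h1.symm.trans (Finset.sum_congr rfl fun m hm => ?_)
    rw [actComp_apply, ← hsmul, Pi.smul_apply]
    congr 1
    exact (congrFun (hF m hm) i).symm
  let c : (Fin (Module.finrank ℂ N) → W) → ℂ := fun m => χ ⟨s m, mem_radCenter hab hLevi (hs m)⟩
  have hcs : ∀ m, actComp g (F m) (s m) = ((c m • F m : N →ₗ⁅ℂ,g⁆ W) : N →ₗ[ℂ] W) := fun m =>
    LinearMap.ext fun n => hw.hasRadCentralChar ⟨s m, mem_radCenter hab hLevi (hs m)⟩ _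
  let f' : N →ₗ⁅ℂ,g⁆ W := ∑ m ∈ t, c m • F m
  have hf' : (f' : N →ₗ[ℂ] W) = ∑ m ∈ t, actComp g (F m) (s m) := by
    let toLin : (N →ₗ⁅ℂ,g⁆ W) →ₗ[ℂ] (N →ₗ[ℂ] W) :=
      { toFun := fun h => h, map_add' := fun _ _ => rfl, map_smul' := fun _ _ => rfl }
    simp_rw [hcs]
    exact map_sum toLin _ _
  have hdiff : ((f - f' : N →ₗ⁅ℂ,g⁆ W) : N →ₗ[ℂ] W) = ∑ m ∈ t, actComp g (F m) (r m) := by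
    have : ((f - f' : N →ₗ⁅ℂ,g⁆ W) : N →ₗ[ℂ] W) = (f : N →ₗ[ℂ] W) - (f' : N →ₗ[ℂ] W) := by
      ext n; simp
    rw [this, hsum, hf', ← Finset.sum_sub_distrib]
    refine Finset.sum_congr rfl fun m _ => ?_
    rw [← hsr m, map_add, add_sub_cancel_left]
  have hzero : ((f - f' : N →ₗ⁅ℂ,g⁆ W) : N →ₗ[ℂ] W) = 0 := by
    -- The difference is invariant as an equivariant map, and by `hdiff` it is also a sum of
    -- brackets in `N →ₗ[ℂ] W`.
    refine eq_zero_of_mem_lieRange (K := ℂ) (g := g) (hw.isLocallyFinite hLevi).linearMap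
      (fun x => ?_) ?_
    · ext n
      rw [LieHom.lie_apply]
      simp
    · rw [hdiff]
      exact sum_mem fun m _ => map_mem_lieRange _ (hr m)
  have hff' : f = f' := by
    ext n
    have := LinearMap.congr_fun hzero n
    simpa [sub_eq_zero] using this
  rw [hff']
  exact sum_mem fun m hm => Submodule.smul_mem _ _
    (Submodule.subset_span (Finset.mem_coe.mpr (Finset.mem_image_of_mem F hm)))

end Spherical

/-! ### Atoms and multiplicities in locally finite modules -/

section HarishChandra

variable {K g X : Type*} [Field K] [LieRing g] [AddCommGroup X] [Module K X] [LieRingModule g X]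

lemma finiteDimensional_of_isAtom (h : IsLocallyFinite K g X) {N : LieSubmodule K g X}
    (hN : IsAtom N) : FiniteDimensional K N := by
  obtain ⟨v, hv, hv0⟩ : ∃ v ∈ N, v ≠ 0 := by
    by_contra! hcon
    exact hN.1 ((LieSubmodule.eq_bot_iff _).mpr hcon)
  obtain ⟨F, hF, hvF⟩ := h v
  have hle : N ≤ F := by
    rcases hN.le_iff.mp (inf_le_left : N ⊓ F ≤ N) with h | h
    · have : v ∈ N ⊓ F := ⟨hv, hvF⟩
      rw [h] at this
      exact absurd ((LieSubmodule.mem_bot _).mp this) hv0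
    · exact inf_eq_left.mp h
  have : FiniteDimensional K F.toSubmodule := hF
  exact Submodule.finiteDimensional_of_le (show N.toSubmodule ≤ F.toSubmodule from hle)

lemma isIrreducible_of_isAtom {N : LieSubmodule K g X} (hN : IsAtom N) :
    LieModule.IsIrreducible K g N := by
  have : Nontrivial N := (LieSubmodule.nontrivial_iff_ne_bot K g X).mpr hN.1
  refine LieModule.IsIrreducible.mk fun N' hN' => ?_
  have hle : N'.map N.incl ≤ N := by
    intro m hm
    obtain ⟨n, -, rfl⟩ := (LieSubmodule.mem_map _).mp hm
    exact n.2
  rcases hN.le_iff.mp hle with h | h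
  · refine absurd ((LieSubmodule.eq_bot_iff _).mpr fun n hn => ?_) hN'
    have : N.incl n ∈ N'.map N.incl := LieSubmodule.mem_map_of_mem hn
    rw [h] at this
    exact Subtype.ext ((LieSubmodule.mem_bot _).mp this)
  · rw [eq_top_iff]
    intro n _
    have : (n : X) ∈ N'.map N.incl := by rw [h]; exact n.2
    obtain ⟨n', hn', hnn⟩ := (LieSubmodule.mem_map _).mp this
    rwa [← Subtype.ext hnn]

variable [LieAlgebra K g] [LieModule K g X]

/-- Independent copies of `N` give linearly independent homomorphisms `N → X`: their values at one
nonzero vector lie in independent submodules. -/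
lemma finite_setOf_equiv {S : Set (LieSubmodule K g X)} (hS : sSupIndep S)
    (N : LieSubmodule K g X) (hN : N ≠ ⊥) [FiniteDimensional K (N →ₗ⁅K,g⁆ X)] :
    {N' ∈ S | Nonempty (N' ≃ₗ⁅K,g⁆ N)}.Finite := by
  set T := {N' ∈ S | Nonempty (N' ≃ₗ⁅K,g⁆ N)}
  obtain ⟨n, hn⟩ : ∃ n : N, n ≠ 0 := by
    have : Nontrivial N := (LieSubmodule.nontrivial_iff_ne_bot K g X).mpr hN
    exact exists_ne 0
  let e : ∀ N' : T, N'.1 ≃ₗ⁅K,g⁆ N := fun N' => N'.2.2.some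
  let f : T → (N →ₗ⁅K,g⁆ X) := fun N' => N'.1.incl.comp ((e N').symm : N →ₗ⁅K,g⁆ N'.1)
  have hind : iSupIndep fun N' : T => N'.1.toSubmodule := by
    rw [LieSubmodule.iSupIndep_toSubmodule]
    exact (sSupIndep_iff _).mp (hS.mono fun N' h => h.1)
  let ev : (N →ₗ⁅K,g⁆ X) →ₗ[K] X :=
    { toFun := fun h => h n
      map_add' := fun _ _ => rfl
      map_smul' := fun _ _ => rfl }
  have hlin : LinearIndependent K f := by
    refine LinearIndependent.of_comp ev (hind.linearIndependent _ (fun N' => ((e N').symm n).2) ?_)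
    intro N' h0
    have h1 : (e N').symm n = 0 := Subtype.ext h0
    exact hn (by rw [← (e N').apply_symm_apply n, h1]; exact map_zero (e N' : N'.1 →ₗ⁅K,g⁆ N))
  have : Finite T := hlin.finite
  exact Set.toFinite T

end HarishChandra

section Spherical

variable {L : Type u} [LieRing L] [LieAlgebra ℂ L] {g : LieSubalgebra ℂ L}
  {W : Type v} [AddCommGroup W] [Module ℂ W] [LieRingModule L W] [LieModule ℂ L W]

theorem IsSphericalVector.isHarishChandra [FiniteDimensional ℂ L] [LieAlgebra.IsSemisimple ℂ g]
    {χ : RadCentralChar L} {w₀ : W} (hw : IsSphericalVector g χ w₀)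
    (hLevi : IsCompl g.toSubmodule (LieAlgebra.radical ℂ L).toSubmodule)
    (hab : IsLieAbelian (LieAlgebra.radical ℂ L)) : IsHarishChandra g W := by
  have hlf := hw.isLocallyFinite hLevi
  obtain ⟨S, hind, htop, hatom⟩ := exists_sSupIndep_of_sSup_atoms_eq_top (sSup_isAtom_eq_top hlf)
  refine ⟨S, fun N hN => ⟨isIrreducible_of_isAtom (hatom hN),
    finiteDimensional_of_isAtom hlf (hatom hN)⟩, hind, htop, fun N hN => ?_⟩
  have := finiteDimensional_of_isAtom hlf (hatom hN)
  have := hw.finiteDimensional_hom hLevi hab (N := N)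
  exact finite_setOf_equiv hind N (hatom hN).1

end Spherical

/-! ### The induced module `Q(0)` and its universal property -/

section Induced

variable {L : Type u} [LieRing L] [LieAlgebra ℂ L] (g : LieSubalgebra ℂ L)

lemma uAct_ind (a : U L) (q : Q0 g) : uAct L (Q0 g) a q = a • q := by
  let S : Subalgebra ℂ (U L) :=
    { carrier := {a | ∀ q, uAct L (Q0 g) a q = a • q}
      mul_mem' := fun {a b} ha hb q => by rw [map_mul, Module.End.mul_apply, ha, hb, mul_smul]
      add_mem' := fun {a b} ha hb q => by rw [map_add, LinearMap.add_apply, ha, hb, add_smul]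
      algebraMap_mem' := fun t q => by
        rw [AlgHom.commutes, Module.algebraMap_end_apply, algebraMap_smul] }
  have hS : S = ⊤ := subalgebra_eq_top S fun x q => uAct_ι x q
  have ha : a ∈ S := by rw [hS]; trivial
  exact ha q

/-- The projection onto `Q(0)`. -/
def toQ0 : U L ⊗[ℂ] Triv g →ₗ[U L] Q0 g := (indRel g (Triv g)).mkQ

lemma toQ0_surjective : Function.Surjective (toQ0 g) := Submodule.mkQ_surjective _

/-- The canonical generator `1 ⊗ 1` of `Q(0)`. -/
def q₀ : Q0 g := toQ0 g ((1 : U L) ⊗ₜ[ℂ] ((TrivialLieModule.equiv ℂ g ℂ).symm 1))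

variable {g}

lemma smul_q₀ (a : U L) : a • q₀ g =
    toQ0 g (a ⊗ₜ[ℂ] ((TrivialLieModule.equiv ℂ g ℂ).symm 1)) := by
  rw [q₀, ← map_smul, TensorProduct.smul_tmul', smul_eq_mul, mul_one]

lemma lie_q₀ {x : L} (hx : x ∈ g) : ⁅x, q₀ g⁆ = 0 := by
  change ι ℂ x • q₀ g = 0
  rw [smul_q₀]
  refine (Submodule.Quotient.mk_eq_zero _).mpr (Submodule.subset_span
    ⟨1, ι ℂ (⟨x, hx⟩ : g), (TrivialLieModule.equiv ℂ g ℂ).symm 1, ?_⟩)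
  rw [uAct_ι, LieModule.IsTrivial.trivial, TensorProduct.tmul_zero, sub_zero, one_mul, uIncl,
    UniversalEnvelopingAlgebra.lift_ι_apply]
  rfl

lemma eq_top_of_q₀_mem (N : LieSubmodule ℂ L (Q0 g)) (h : q₀ g ∈ N) : N = ⊤ := by
  rw [eq_top_iff]
  intro q _
  obtain ⟨t, rfl⟩ := toQ0_surjective g q
  induction t using TensorProduct.induction_on with
  | zero => exact zero_mem N
  | add s t hs ht => exact add_mem (hs trivial) (ht trivial)
  | tmul a c =>
    have h1 : a ⊗ₜ[ℂ] c = (((TrivialLieModule.equiv ℂ g ℂ) c) • a) ⊗ₜ[ℂ]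
        ((TrivialLieModule.equiv ℂ g ℂ).symm 1) := by
      rw [TensorProduct.smul_tmul, ← map_smul, smul_eq_mul, mul_one, LinearEquiv.symm_apply_apply]
    rw [h1, ← smul_q₀, ← uAct_ind]
    exact uAct_mem N _ h

/-- The universal property of `Q(0)`, for a representation of `U(L)`. -/
lemma exists_lift {M : Type v} [AddCommGroup M] [Module ℂ M] (ψ : U L →ₐ[ℂ] Module.End ℂ M)
    (m : M) (hm : ∀ x ∈ g, ψ (ι ℂ x) m = 0) :
    ∃ φ : Q0 g →ₗ[ℂ] M, φ (q₀ g) = m ∧ ∀ a q, φ (a • q) = ψ a (φ q) := by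
  let β : U L ⊗[ℂ] Triv g →ₗ[ℂ] M := TensorProduct.lift
    (LinearMap.mk₂ ℂ (fun a c => (TrivialLieModule.equiv ℂ g ℂ c) • ψ a m)
      (by simp) (fun t a c => by rw [map_smul, LinearMap.smul_apply, smul_comm]) (by simp [add_smul])
      (by intro t a c; simp [mul_smul]))
  have hβ : ∀ a c, β (a ⊗ₜ[ℂ] c) = (TrivialLieModule.equiv ℂ g ℂ c) • ψ a m := fun _ _ => rfl
  have hβs : ∀ a t, β (a • t) = ψ a (β t) := fun a t => by
    induction t using TensorProduct.induction_on with
    | zero => simp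
    | add s t hs ht => rw [smul_add, map_add, map_add, map_add, hs, ht]
    | tmul b c =>
      rw [TensorProduct.smul_tmul', smul_eq_mul, hβ, hβ, map_mul, Module.End.mul_apply, map_smul]
  -- `U(g)` acts on `m` as on the trivial module; this makes `β` kill the tensor relations over
  -- `U(g)`.
  have hrel : ∀ (a : U g) (c : Triv g), (TrivialLieModule.equiv ℂ g ℂ c) • ψ (uIncl g a) m =
      (TrivialLieModule.equiv ℂ g ℂ (uAct g (Triv g) a c)) • m := fun a => by
    let S : Subalgebra ℂ (U g) :=
      { carrier := {a | ∀ c : Triv g, (TrivialLieModule.equiv ℂ g ℂ c) • ψ (uIncl g a) m =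
          (TrivialLieModule.equiv ℂ g ℂ (uAct g (Triv g) a c)) • m}
        mul_mem' := fun {a b} ha hb c => by
          rw [map_mul, map_mul, map_mul, Module.End.mul_apply, Module.End.mul_apply, ← map_smul,
            hb c, map_smul, ha]
        add_mem' := fun {a b} ha hb c => by
          simp only [map_add, LinearMap.add_apply, smul_add, add_smul]
          rw [ha, hb]
        algebraMap_mem' := fun t c => by
          simp only [AlgHom.commutes, Module.algebraMap_end_apply, map_smul, smul_assoc]
          rw [smul_comm] }
    have hS : S = ⊤ := subalgebra_eq_top S fun x c => by
      have h1 : uIncl g (ι ℂ x) = ι ℂ (x : L) := by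
        rw [uIncl, UniversalEnvelopingAlgebra.lift_ι_apply]; rfl
      rw [uAct_ι, LieModule.IsTrivial.trivial, map_zero, zero_smul, h1, hm x x.2, smul_zero]
    have ha : a ∈ S := by rw [hS]; trivial
    exact ha
  have hker : (indRel g (Triv g)).restrictScalars ℂ ≤ LinearMap.ker β := by
    intro t ht
    rw [LinearMap.mem_ker]
    replace ht : t ∈ indRel g (Triv g) := ht
    rw [indRel] at ht
    induction ht using Submodule.span_induction with
    | mem t ht =>
      obtain ⟨b, a, c, rfl⟩ := ht
      rw [map_sub, hβ, hβ, map_mul, Module.End.mul_apply, ← map_smul, hrel, map_smul, sub_self]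
    | zero => exact map_zero β
    | add s t _ _ hs ht => rw [map_add, hs, ht, add_zero]
    | smul a t _ ht => rw [hβs, ht, map_zero]
  let φ : Q0 g →ₗ[ℂ] M := (((indRel g (Triv g)).restrictScalars ℂ).liftQ β hker).comp
    (Submodule.Quotient.restrictScalarsEquiv ℂ (indRel g (Triv g))).symm.toLinearMap
  have hφ : ∀ t, φ (toQ0 g t) = β t := fun t => rfl
  refine ⟨φ, ?_, fun a q => ?_⟩
  · rw [q₀, hφ, hβ]
    simp
  · obtain ⟨t, rfl⟩ := toQ0_surjective g q
    rw [← map_smul, hφ, hφ, hβs]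

/-- The universal property of `Q(0)`, for an `L`-module. -/
lemma exists_lieModuleHom_q₀ {W : Type v} [AddCommGroup W] [Module ℂ W] [LieRingModule L W]
    [LieModule ℂ L W] {w₀ : W} (hw : ∀ x ∈ g, ⁅x, w₀⁆ = 0) :
    ∃ φ : Q0 g →ₗ⁅ℂ,L⁆ W, φ (q₀ g) = w₀ := by
  obtain ⟨φ, h1, h2⟩ := exists_lift (uAct L W) w₀ fun x hx => by rw [uAct_ι, hw x hx]
  exact ⟨{ φ with map_lie' := fun {x q} => (h2 (ι ℂ x) q).trans (uAct_ι x _) }, h1⟩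

lemma isSphericalVector_mk_q₀ (χ : RadCentralChar L) :
    IsSphericalVector g χ (LieSubmodule.Quotient.mk' (mQ g χ) (q₀ g)) where
  lie_eq_zero x hx := by rw [← LieModuleHom.map_lie, lie_q₀ hx, map_zero]
  eq_top N hN := by
    have h := eq_top_of_q₀_mem (N.comap (LieSubmodule.Quotient.mk' (mQ g χ))) hN
    rw [eq_top_iff]
    intro m _
    obtain ⟨q, rfl⟩ := LieSubmodule.Quotient.surjective_mk' _ m
    have hq : q ∈ N.comap (LieSubmodule.Quotient.mk' (mQ g χ)) := by rw [h]; trivial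
    exact hq
  hasRadCentralChar z m := by
    obtain ⟨q, rfl⟩ := LieSubmodule.Quotient.surjective_mk' _ m
    rw [← uAct_map, ← map_smul, ← sub_eq_zero, ← map_sub, LieSubmodule.Quotient.mk_eq_zero]
    -- The element `z - χ z` lies in the kernel of `χ`.
    refine LieSubmodule.subset_lieSpan ⟨z - algebraMap ℂ _ (χ z), q, ?_, ?_⟩
    · rw [map_sub, AlgHom.commutes, Algebra.algebraMap_self_apply, sub_self]
    · have : ((z - algebraMap ℂ (radCenter L) (χ z) : radCenter L) : U L) =
          (z : U L) - algebraMap ℂ (U L) (χ z) := rfl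
      rw [this, map_sub, LinearMap.sub_apply, AlgHom.commutes, Module.algebraMap_end_apply]

end Induced

/-! ### Nonvanishing of `Q(0, χ)` -/

section Nonzero

variable {L : Type u} [LieRing L] [LieAlgebra ℂ L] {g : LieSubalgebra ℂ L}
  (hLevi : IsCompl g.toSubmodule (LieAlgebra.radical ℂ L).toSubmodule)

/-- The projection onto `g` has kernel the ideal `r`, so it is the quotient map `L → L/r ≅ g`. -/
lemma projection_lie (x y : L) :
    g.toSubmodule.projection _ hLevi ⁅x, y⁆ =
      ⁅g.toSubmodule.projection _ hLevi x, g.toSubmodule.projection _ hLevi y⁆ := by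
  set p := g.toSubmodule.projection _ hLevi
  have hx : x - p x ∈ LieAlgebra.radical ℂ L := Submodule.sub_projection_mem hLevi x
  have hy : y - p y ∈ LieAlgebra.radical ℂ L := Submodule.sub_projection_mem hLevi y
  have h : ⁅x, y⁆ = ⁅p x, p y⁆ + (⁅x, y - p y⁆ + ⁅x - p x, p y⁆) := by
    rw [lie_sub, sub_lie]; abel
  have h1 : ⁅x, y - p y⁆ + ⁅x - p x, p y⁆ ∈ LieAlgebra.radical ℂ L :=
    add_mem ((LieAlgebra.radical ℂ L).lie_mem hy) (lie_mem_left ℂ L _ _ _ hx)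
  have h2 : ⁅p x, p y⁆ ∈ g := g.lie_mem (Submodule.projection_apply_mem hLevi x)
    (Submodule.projection_apply_mem hLevi y)
  rw [h, map_add, (Submodule.projection_apply_eq_zero_iff hLevi).mpr h1, add_zero,
    Submodule.projection_apply_of_mem_left hLevi h2]

/-- The representation of `L` on the image of `U(r)` in which `g` acts by commutators and `r` by
left multiplication. -/
def radRep : L →ₗ⁅ℂ⁆ Module.End ℂ (radAlg L) where
  toFun x :=
    { toFun := fun a => ⟨ι ℂ x * a - a * ι ℂ (g.toSubmodule.projection _ hLevi x), by
        have h : ι ℂ x * (a : U L) - a * ι ℂ (g.toSubmodule.projection _ hLevi x) =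
            (ι ℂ (g.toSubmodule.projection _ hLevi x) * (a : U L) -
              a * ι ℂ (g.toSubmodule.projection _ hLevi x)) +
            ι ℂ (x - g.toSubmodule.projection _ hLevi x) * a := by
          rw [map_sub]; noncomm_ring
        rw [h]
        exact add_mem (commutator_mem_radAlg _ a.2)
          (mul_mem (ι_mem_radAlg (Submodule.sub_projection_mem hLevi x)) a.2)⟩
      map_add' := fun a b => Subtype.ext <| by simp [mul_add, add_mul, add_sub_add_comm]
      map_smul' := fun t a => Subtype.ext <| by simp [smul_sub] }
  map_add' x y := by
    ext a
    simp [mul_add, add_mul, add_sub_add_comm]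
  map_smul' t x := by
    ext a
    simp [smul_sub]
  map_lie' {x y} := by
    ext a
    simp only [LieRing.of_associative_ring_bracket, LinearMap.coe_mk, AddHom.coe_mk,
      LinearMap.sub_apply, Module.End.mul_apply, AddSubgroupClass.coe_sub, projection_lie,
      ← ι_mul_sub]
    noncomm_ring

lemma coe_radRep_apply (x : L) (a : radAlg L) : (radRep hLevi x a : U L) =
    ι ℂ x * a - a * ι ℂ (g.toSubmodule.projection _ hLevi x) := rfl

lemma lift_radRep_apply {z : U L} (hz : z ∈ radAlg L) (a : radAlg L) :
    (UniversalEnvelopingAlgebra.lift ℂ (radRep hLevi) z a : U L) = z * a := by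
  rw [radAlg_eq_adjoin] at hz
  induction hz using Algebra.adjoin_induction generalizing a with
  | mem z hz =>
    obtain ⟨y, hy, rfl⟩ := hz
    rw [UniversalEnvelopingAlgebra.lift_ι_apply, coe_radRep_apply,
      (Submodule.projection_apply_eq_zero_iff hLevi).mpr hy, map_zero, mul_zero, sub_zero]
  | algebraMap t =>
    rw [AlgHom.commutes, Module.algebraMap_end_apply, Algebra.algebraMap_eq_smul_one,
      smul_mul_assoc, one_mul]
    rfl
  | add y z _ _ hy hz =>
    rw [map_add, LinearMap.add_apply, add_mul, ← hy, ← hz]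
    rfl
  | mul y z _ _ hy hz => rw [map_mul, Module.End.mul_apply, hy, hz, mul_assoc]

lemma mem_maxTrivSubmodule_of_mem_radCenter {a : radAlg L} (ha : (a : U L) ∈ radCenter L) :
    a ∈ maxTrivSubmodule ℂ g (radAlg L) := fun x => Subtype.ext <| by
  have h := (Subalgebra.mem_center_iff.mp ha.1) (ι ℂ (x : L))
  change ι ℂ (x : L) * (a : U L) - a * ι ℂ (x : L) = 0
  rw [h, sub_self]

variable [FiniteDimensional ℂ L] [LieAlgebra.IsSemisimple ℂ g]
  (hab : IsLieAbelian (LieAlgebra.radical ℂ L))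

-- The representation `radRep` receives a map from `Q(0)` with `q₀ ↦ 1` and `m_χ Q(0)` mapped into
-- `I = m_χ · radAlg L`. It remains to see that `1 ∉ I`: the invariant part of an element of `I`
-- lies in the kernel of `χ`, whereas `1` is its own invariant part and `χ 1 = 1`.
include hLevi hab in
lemma q₀_notMem (χ : RadCentralChar L) : q₀ g ∉ mQ g χ := by
  intro hmem
  obtain ⟨φ, hφ1, hφ⟩ := exists_lift (UniversalEnvelopingAlgebra.lift ℂ (radRep hLevi))
    (1 : radAlg L) fun x hx => by
      refine Subtype.ext ?_
      rw [UniversalEnvelopingAlgebra.lift_ι_apply, coe_radRep_apply,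
        Submodule.projection_apply_of_mem_left hLevi (show x ∈ g.toSubmodule from hx)]
      simp
  let I : Submodule ℂ (radAlg L) :=
    Submodule.span ℂ {b | ∃ (z : radCenter L) (a : radAlg L), χ z = 0 ∧ (b : U L) = z * a}
  have hI : ∀ x : L, ∀ b ∈ I, radRep hLevi x b ∈ I := fun x b hb => by
    induction hb using Submodule.span_induction with
    | mem b hb =>
      obtain ⟨z, a, hz, hb⟩ := hb
      refine Submodule.subset_span ⟨z, radRep hLevi x a, hz, ?_⟩
      rw [coe_radRep_apply, coe_radRep_apply, hb, mul_sub, ← mul_assoc,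
        (Subalgebra.mem_center_iff.mp z.2.1) (ι ℂ x), mul_assoc, mul_assoc]
    | zero => rw [map_zero]; exact zero_mem _
    | add a b _ _ ha hb => rw [map_add]; exact add_mem ha hb
    | smul t a _ ha => rw [map_smul]; exact I.smul_mem t ha
  let N : LieSubmodule ℂ L (Q0 g) :=
    { __ := I.comap φ
      lie_mem := fun {x q} hq => by
        have h : φ ⁅x, q⁆ = radRep hLevi x (φ q) := by
          change φ (ι ℂ x • q) = _
          rw [hφ, UniversalEnvelopingAlgebra.lift_ι_apply]
        change φ ⁅x, q⁆ ∈ I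
        rw [h]
        exact hI x _ hq }
  have hle : mQ g χ ≤ N := by
    refine LieSubmodule.lieSpan_le.mpr ?_
    rintro _ ⟨z, q, hz, rfl⟩
    refine Submodule.subset_span ⟨z, φ q, hz, ?_⟩
    rw [uAct_ind, hφ, lift_radRep_apply hLevi z.2.2]
  have h1 : (1 : radAlg L) ∈ I := hφ1 ▸ hle hmem
  have hdec : ∀ b ∈ I, ∃ z : radCenter L, χ z = 0 ∧ ∃ t ∈ lieRange ℂ g (radAlg L),
      (b : U L) = z + t := fun b hb => by
    induction hb using Submodule.span_induction with
    | mem b hb =>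
      obtain ⟨z, a, hz, hb⟩ := hb
      obtain ⟨s, hs, t, ht, rfl⟩ := exists_add_eq (isLocallyFinite_radAlg g) a
      -- Multiplication by a central element is `g`-equivariant, so it respects the splitting `a = s
      -- + t`.
      let f : radAlg L →ₗ⁅ℂ,g⁆ radAlg L :=
        { LinearMap.mulLeft ℂ (⟨z, z.2.2⟩ : radAlg L) with
          map_lie' := fun {x c} => Subtype.ext <| by
            change (z : U L) * (ι ℂ (x : L) * c - c * ι ℂ (x : L)) =
              ι ℂ (x : L) * (z * c) - z * c * ι ℂ (x : L)
            rw [mul_sub, ← mul_assoc, ← mul_assoc, ← mul_assoc,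
              (Subalgebra.mem_center_iff.mp z.2.1) (ι ℂ (x : L))] }
      refine ⟨z * ⟨s, mem_radCenter hab hLevi hs⟩, by rw [map_mul, hz, zero_mul], f t,
        map_mem_lieRange f ht, ?_⟩
      rw [hb]
      exact mul_add _ _ _
    | zero => exact ⟨0, map_zero χ, 0, zero_mem _, (add_zero _).symm⟩
    | add a b _ _ ha hb =>
      obtain ⟨z, hz, t, ht, ha⟩ := ha
      obtain ⟨z', hz', t', ht', hb⟩ := hb
      refine ⟨z + z', by rw [map_add, hz, hz', add_zero], t + t', add_mem ht ht', ?_⟩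
      have : ((a + b : radAlg L) : U L) = a + b := rfl
      rw [this, ha, hb]
      exact add_add_add_comm _ _ _ _
    | smul c a _ ha =>
      obtain ⟨z, hz, t, ht, ha⟩ := ha
      refine ⟨c • z, by rw [map_smul, hz, smul_zero], c • t, Submodule.smul_mem _ c ht, ?_⟩
      have : ((c • a : radAlg L) : U L) = c • (a : U L) := rfl
      rw [this, ha]
      exact smul_add _ _ _
  obtain ⟨z, hz, t, ht, hzt⟩ := hdec 1 h1
  have hzt' : t = 1 - (⟨z, z.2.2⟩ : radAlg L) := by
    rw [eq_sub_iff_add_eq']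
    exact Subtype.ext hzt.symm
  have ht0 : t = 0 := by
    refine eq_zero_of_mem_lieRange (isLocallyFinite_radAlg g) ?_ ht
    rw [hzt']
    exact sub_mem (mem_maxTrivSubmodule_of_mem_radCenter (one_mem (radCenter L)))
      (mem_maxTrivSubmodule_of_mem_radCenter z.2)
  have hz1 : z = 1 := by
    refine Subtype.ext ?_
    rw [ht0] at hzt
    exact (hzt.trans (add_zero _)).symm
  rw [hz1, map_one] at hz
  exact one_ne_zero hz

end Nonzero

/-! ### Simple quotients and trivial submodules -/

section Quotient

variable {L : Type u} [LieRing L] [LieAlgebra ℂ L]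
  {X : Type v} [AddCommGroup X] [Module ℂ X] [LieRingModule L X] [LieModule ℂ L X]
  {Y : Type w} [AddCommGroup Y] [Module ℂ Y] [LieRingModule L Y] [LieModule ℂ L Y]

/-- The homomorphism on a quotient induced by a homomorphism that vanishes on the submodule. -/
def quotientLift (N : LieSubmodule ℂ L X) (f : X →ₗ⁅ℂ,L⁆ Y) (h : N ≤ f.ker) :
    X ⧸ N →ₗ⁅ℂ,L⁆ Y where
  __ := N.toSubmodule.liftQ (f : X →ₗ[ℂ] Y) h
  map_lie' {x m} := by
    obtain ⟨m, rfl⟩ := LieSubmodule.Quotient.surjective_mk' N m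
    rw [← LieModuleHom.map_lie]
    exact f.map_lie x m

omit [LieModule ℂ L Y] in
lemma nonempty_quotient_equiv (N : LieSubmodule ℂ L X) (f : X →ₗ⁅ℂ,L⁆ Y) (h : f.ker = N)
    (hf : Function.Surjective f) : Nonempty (Y ≃ₗ⁅ℂ,L⁆ X ⧸ N) := by
  let F := quotientLift N f h.ge
  have hinj : Function.Injective F := by
    rw [injective_iff_map_eq_zero]
    intro m hm
    obtain ⟨m, rfl⟩ := LieSubmodule.Quotient.surjective_mk' N m
    rw [LieSubmodule.Quotient.mk_eq_zero, ← h]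
    exact hm
  have hsurj : Function.Surjective F := fun y => by
    obtain ⟨m, rfl⟩ := hf y
    exact ⟨LieSubmodule.Quotient.mk' N m, rfl⟩
  let e := LinearEquiv.ofBijective (F : X ⧸ N →ₗ[ℂ] Y) ⟨hinj, hsurj⟩
  let e' : (X ⧸ N) ≃ₗ⁅ℂ,L⁆ Y := { e with map_lie' := fun {x m} => F.map_lie x m }
  exact ⟨e'.symm⟩

-- The kernel is proper, hence inside the sum of proper submodules. The image of that sum in the
-- simple module is zero or everything; in the latter case the sum, containing the kernel, would be
-- everything.
omit [LieAlgebra ℂ L] [LieModule ℂ L X] [LieModule ℂ L Y] in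
lemma ker_eq_sSup_of_isIrreducible (hX : sSup {N : LieSubmodule ℂ L X | N ≠ ⊤} ≠ ⊤)
    [LieModule.IsIrreducible ℂ L Y] (f : X →ₗ⁅ℂ,L⁆ Y) (hf : Function.Surjective f) :
    f.ker = sSup {N : LieSubmodule ℂ L X | N ≠ ⊤} := by
  have hle : f.ker ≤ sSup {N : LieSubmodule ℂ L X | N ≠ ⊤} := by
    refine le_sSup fun htop => ?_
    have := LieModule.nontrivial_of_isIrreducible ℂ L Y
    obtain ⟨y, hy⟩ := exists_ne (0 : Y)
    obtain ⟨m, rfl⟩ := hf y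
    have hm : m ∈ f.ker := by rw [htop]; trivial
    exact hy (LieModuleHom.mem_ker.mp hm)
  refine le_antisymm hle ?_
  rcases IsSimpleOrder.eq_bot_or_eq_top ((sSup {N : LieSubmodule ℂ L X | N ≠ ⊤}).map f)
    with h | h
  · intro m hm
    have : f m ∈ (sSup {N : LieSubmodule ℂ L X | N ≠ ⊤}).map f :=
      LieSubmodule.mem_map_of_mem hm
    rw [h] at this
    exact LieModuleHom.mem_ker.mpr ((LieSubmodule.mem_bot _).mp this)
  · refine absurd (eq_top_iff.mpr fun m _ => ?_) hX
    have : f m ∈ (sSup {N : LieSubmodule ℂ L X | N ≠ ⊤}).map f := by rw [h]; trivial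
    obtain ⟨n, hn, hnm⟩ := (LieSubmodule.mem_map _).mp this
    have hk : m - n ∈ f.ker := by rw [LieModuleHom.mem_ker, map_sub, hnm, sub_self]
    rw [← sub_add_cancel m n]
    exact add_mem (hle hk) hn

lemma isIrreducible_quotient_iff (hX : sSup {N : LieSubmodule ℂ L X | N ≠ ⊤} ≠ ⊤)
    (N : LieSubmodule ℂ L X) :
    LieModule.IsIrreducible ℂ L (X ⧸ N) ↔ N = sSup {N : LieSubmodule ℂ L X | N ≠ ⊤} := by
  constructor
  · intro h
    rw [← ker_eq_sSup_of_isIrreducible hX (LieSubmodule.Quotient.mk' N)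
      (LieSubmodule.Quotient.surjective_mk' N), LieSubmodule.Quotient.mk'_ker]
  · intro h
    have hnt : Nontrivial (X ⧸ N) := by
      refine Submodule.Quotient.nontrivial_iff.mpr fun htop => hX ?_
      rw [← h]
      exact (LieSubmodule.toSubmodule_eq_top N).mp htop
    refine LieModule.IsIrreducible.mk fun N' hN' => ?_
    by_contra hne
    refine hN' ((LieSubmodule.eq_bot_iff _).mpr fun m hm => ?_)
    obtain ⟨m, rfl⟩ := LieSubmodule.Quotient.surjective_mk' N m
    rw [LieSubmodule.Quotient.mk_eq_zero, h]
    refine (le_sSup (α := LieSubmodule ℂ L X) (s := {N | N ≠ ⊤})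
      (a := N'.comap (LieSubmodule.Quotient.mk' N)) fun htop => hne ?_) hm
    rw [eq_top_iff]
    intro y _
    obtain ⟨y, rfl⟩ := LieSubmodule.Quotient.surjective_mk' N y
    have hy : y ∈ N'.comap (LieSubmodule.Quotient.mk' N) := by rw [htop]; trivial
    exact hy

lemma IsSphericalVector.map {g : LieSubalgebra ℂ L} {χ : RadCentralChar L} {w₀ : X}
    (hw : IsSphericalVector g χ w₀) (f : X →ₗ⁅ℂ,L⁆ Y) (hf : Function.Surjective f) :
    IsSphericalVector g χ (f w₀) where
  lie_eq_zero x hx := by rw [← LieModuleHom.map_lie, hw.lie_eq_zero x hx, map_zero]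
  eq_top N hN := by
    have h := hw.eq_top (N.comap f) hN
    rw [eq_top_iff]
    intro y _
    obtain ⟨m, rfl⟩ := hf y
    have hm : m ∈ N.comap f := by rw [h]; trivial
    exact hm
  hasRadCentralChar := hw.hasRadCentralChar.of_surjective f hf

lemma isSphericalVector_of_isIrreducible {g : LieSubalgebra ℂ L} {χ : RadCentralChar L}
    [LieModule.IsIrreducible ℂ L X] (hχ : HasRadCentralChar χ X) {w₀ : X} (h0 : w₀ ≠ 0)
    (hw : ∀ x ∈ g, ⁅x, w₀⁆ = 0) : IsSphericalVector g χ w₀ where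
  lie_eq_zero := hw
  eq_top N hN := (IsSimpleOrder.eq_bot_or_eq_top N).resolve_left fun h => h0 <| by
    rw [h] at hN
    exact (LieSubmodule.mem_bot _).mp hN
  hasRadCentralChar := hχ

lemma exists_equiv_triv {v : X} (h0 : v ≠ 0) (hv : ∀ x : L, ⁅x, v⁆ = 0) :
    ∃ N : LieSubmodule ℂ L X, v ∈ N ∧ Nonempty (Triv L ≃ₗ⁅ℂ,L⁆ N) := by
  let N : LieSubmodule ℂ L X :=
    { __ := Submodule.span ℂ {v}
      lie_mem := fun {x m} hm => by
        obtain ⟨t, rfl⟩ := Submodule.mem_span_singleton.mp hm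
        rw [lie_smul, hv, smul_zero]
        exact Submodule.zero_mem _ }
  let e : Triv L ≃ₗ[ℂ] N :=
    (TrivialLieModule.equiv ℂ L ℂ).trans (LinearEquiv.toSpanNonzeroSingleton ℂ X v h0)
  refine ⟨N, Submodule.mem_span_singleton_self v, ⟨{ e with map_lie' := fun {x m} => ?_ }⟩⟩
  change e ⁅x, m⁆ = ⁅x, e m⁆
  rw [LieModule.IsTrivial.trivial, map_zero]
  refine Subtype.ext ?_
  change (0 : X) = ⁅x, (TrivialLieModule.equiv ℂ L ℂ m) • v⁆
  rw [lie_smul, hv, smul_zero]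

omit [LieModule ℂ L X] in
lemma exists_invariant_of_hasType {g : LieSubalgebra ℂ L} (h : HasType g X (Triv g)) :
    ∃ w₀ : X, w₀ ≠ 0 ∧ ∀ x ∈ g, ⁅x, w₀⁆ = 0 := by
  obtain ⟨N, ⟨e⟩⟩ := h
  let c : Triv g := (TrivialLieModule.equiv ℂ g ℂ).symm 1
  have hc : c ≠ 0 := (LinearEquiv.map_ne_zero_iff _).mpr one_ne_zero
  refine ⟨e c, fun h => hc ?_, fun x hx => ?_⟩
  · refine e.injective ?_
    have h0 : e c = 0 := Subtype.ext h
    rw [h0]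
    exact (map_zero (e : Triv g →ₗ⁅ℂ,g⁆ N)).symm
  · have h1 : ⁅(⟨x, hx⟩ : g), e c⁆ = 0 := by
      have := (e : Triv g →ₗ⁅ℂ,g⁆ N).map_lie ⟨x, hx⟩ c
      rw [LieModule.IsTrivial.trivial, map_zero] at this
      exact this.symm
    exact congrArg Subtype.val h1

omit [LieAlgebra ℂ L] in
lemma isIrreducible_triv : LieModule.IsIrreducible ℂ L (Triv L) := by
  have : Nontrivial (Triv L) := inferInstanceAs (Nontrivial ℂ)
  refine LieModule.IsIrreducible.mk fun N hN => eq_top_iff.mpr fun m _ => ?_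
  obtain ⟨n, hn, hn0⟩ : ∃ n ∈ N, n ≠ 0 := by
    by_contra! hcon
    exact hN ((LieSubmodule.eq_bot_iff _).mpr hcon)
  have hn0' : (show ℂ from n) ≠ 0 := hn0
  have h : ((show ℂ from m) / (show ℂ from n)) • n = m := div_mul_cancel₀ (show ℂ from m) hn0'
  rw [← h]
  exact N.smul_mem _ hn

/-- In a finite-dimensional simple module, `[g, r] = r` forces the radical `r` to act by zero. -/
lemma lie_radical_eq_zero [FiniteDimensional ℂ L] [FiniteDimensional ℂ X]
    [LieModule.IsIrreducible ℂ L X] {g : LieSubalgebra ℂ L}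
    (hgr : Submodule.span ℂ {z : L | ∃ x ∈ g, ∃ y ∈ LieAlgebra.radical ℂ L, ⁅x, y⁆ = z} =
      (LieAlgebra.radical ℂ L).toSubmodule) {z : L} (hz : z ∈ LieAlgebra.radical ℂ L) (m : X) :
    ⁅z, m⁆ = 0 := by
  have hnt := LieModule.nontrivial_of_isIrreducible ℂ L X
  -- Lie's theorem gives a common eigenvector of the radical. Its weight space is `L`-stable, hence
  -- all of `X`, so the radical acts by scalars; on brackets `⁅x, y⁆` the scalar vanishes, since a
  -- commutator has trace zero.
  obtain ⟨μ, hμ⟩ : ∃ μ : Module.Dual ℂ (LieAlgebra.radical ℂ L), Nontrivial (weightSpace X μ) :=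
    exists_nontrivial_weightSpace_of_isSolvable ℂ (LieAlgebra.radical ℂ L) X
  let N : LieSubmodule ℂ L X := weightSpaceOfIsLieTower ℂ X μ
  replace hμ : Nontrivial N := hμ
  replace hμ : N = ⊤ := N.eq_top_of_isIrreducible ℂ L X
  have hact : ∀ (y : L) (hy : y ∈ LieAlgebra.radical ℂ L),
      toEnd ℂ L X y = μ ⟨y, hy⟩ • LinearMap.id := fun y hy => by
    ext m
    have hm : ∀ (y : L) (hy : y ∈ LieAlgebra.radical ℂ L), ⁅y, m⁆ = μ ⟨y, hy⟩ • m := by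
      simpa [N, weightSpaceOfIsLieTower, mem_weightSpace] using
        (hμ ▸ LieSubmodule.mem_top m : m ∈ N)
    simpa using hm y hy
  have hle : (LieAlgebra.radical ℂ L).toSubmodule ≤ LinearMap.ker (toEnd ℂ L X).toLinearMap := by
    rw [← hgr, Submodule.span_le]
    rintro _ ⟨x, -, y, hy, rfl⟩
    have hxy := (LieAlgebra.radical ℂ L).lie_mem (x := x) hy
    have htr : LinearMap.trace ℂ X (toEnd ℂ L X ⁅x, y⁆) = 0 := by
      rw [LieHom.map_lie, LinearMap.trace_lie]
    have h0 : μ ⟨⁅x, y⁆, hxy⟩ = 0 := by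
      rw [hact _ hxy, map_smul, LinearMap.trace_id, smul_eq_mul] at htr
      refine (mul_eq_zero.mp htr).resolve_right ?_
      exact_mod_cast Module.finrank_pos.ne'
    change toEnd ℂ L X ⁅x, y⁆ = 0
    rw [hact _ hxy, h0, zero_smul]
  have h := LinearMap.congr_fun (LinearMap.mem_ker.mp (hle hz)) m
  exact h

end Quotient

/-! ### The module `V(0, χ)` -/

section Main

variable {L : Type u} [LieRing L] [LieAlgebra ℂ L] [FiniteDimensional ℂ L]
  {g : LieSubalgebra ℂ L} [LieAlgebra.IsSemisimple ℂ g]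
  (hLevi : IsCompl g.toSubmodule (LieAlgebra.radical ℂ L).toSubmodule)
  (hab : IsLieAbelian (LieAlgebra.radical ℂ L)) (χ : RadCentralChar L)

include hLevi hab

lemma maxSub_ne_top : maxSub g χ ≠ ⊤ :=
  (isSphericalVector_mk_q₀ χ).sSup_ne_top hLevi hab fun h =>
    q₀_notMem hLevi hab χ ((LieSubmodule.Quotient.mk_eq_zero _).mp h)

lemma isIrreducible_V : LieModule.IsIrreducible ℂ L (V g χ) :=
  (isIrreducible_quotient_iff (maxSub_ne_top hLevi hab χ) _).mpr rfl

omit [FiniteDimensional ℂ L] [LieAlgebra.IsSemisimple ℂ g] hLevi hab in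
lemma isSphericalVector_V : IsSphericalVector g χ
    (LieSubmodule.Quotient.mk' (maxSub g χ) (LieSubmodule.Quotient.mk' (mQ g χ) (q₀ g))) :=
  (isSphericalVector_mk_q₀ χ).map _ (LieSubmodule.Quotient.surjective_mk' _)

theorem nonempty_equiv_V {W : Type v} [AddCommGroup W] [Module ℂ W] [LieRingModule L W]
    [LieModule ℂ L W] (hW : LieModule.IsIrreducible ℂ L W) (hχ : HasRadCentralChar χ W)
    (htype : HasType g W (Triv g)) : Nonempty (W ≃ₗ⁅ℂ,L⁆ V g χ) := by
  obtain ⟨w₀, h0, hw⟩ := exists_invariant_of_hasType htype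
  have hsph := isSphericalVector_of_isIrreducible hχ h0 hw
  obtain ⟨φ, hφ⟩ := exists_lieModuleHom_q₀ hw
  have hker : mQ g χ ≤ φ.ker := by
    refine LieSubmodule.lieSpan_le.mpr ?_
    rintro _ ⟨z, q, hz, rfl⟩
    refine LieModuleHom.mem_ker.mpr ?_
    rw [uAct_map, hχ, hz, zero_smul]
  let f := quotientLift (mQ g χ) φ hker
  have hf : Function.Surjective f := by
    have htop : f.range = ⊤ := hsph.eq_top _
      ((LieModuleHom.mem_range _ _).mpr ⟨LieSubmodule.Quotient.mk' _ (q₀ g), hφ⟩)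
    intro m
    have hm : m ∈ f.range := by rw [htop]; trivial
    exact (LieModuleHom.mem_range _ _).mp hm
  exact nonempty_quotient_equiv _ f
    (ker_eq_sSup_of_isIrreducible (maxSub_ne_top hLevi hab χ) f hf) hf

lemma hasType_V : HasType g (V g χ) (Triv g) := by
  have := isIrreducible_V hLevi hab χ
  have hnt := LieModule.nontrivial_of_isIrreducible ℂ L (V g χ)
  have hw := isSphericalVector_V (g := g) χ
  have h0 : LieSubmodule.Quotient.mk' (maxSub g χ)
      (LieSubmodule.Quotient.mk' (mQ g χ) (q₀ g)) ≠ 0 := fun h0 => by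
    have hbot : (⊥ : LieSubmodule ℂ L (V g χ)) = ⊤ := hw.eq_top _ (by rw [h0]; exact zero_mem _)
    exact bot_ne_top hbot
  obtain ⟨N, -, hN⟩ := exists_equiv_triv (L := g) h0 fun x => hw.lie_eq_zero x x.2
  exact ⟨N, hN⟩

/-- The `g`-invariant vector is also killed by the radical, so it spans a trivial `L`-submodule,
which by simplicity is the whole module. -/
lemma nonempty_equiv_triv [FiniteDimensional ℂ (V g χ)]
    (hgr : Submodule.span ℂ {z : L | ∃ x ∈ g, ∃ y ∈ LieAlgebra.radical ℂ L, ⁅x, y⁆ = z} =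
      (LieAlgebra.radical ℂ L).toSubmodule) : Nonempty (V g χ ≃ₗ⁅ℂ,L⁆ Triv L) := by
  have hirr := isIrreducible_V hLevi hab χ
  obtain ⟨w₀, h0, hw⟩ := exists_invariant_of_hasType (hasType_V hLevi hab χ)
  have hsph := isSphericalVector_of_isIrreducible (isSphericalVector_V χ).hasRadCentralChar h0 hw
  obtain ⟨N, hN, ⟨e⟩⟩ := exists_equiv_triv (L := L) h0 fun x => by
    obtain ⟨y, hy, z, hz, rfl⟩ := exists_levi hLevi x
    rw [add_lie, hw y hy, lie_radical_eq_zero hgr hz, add_zero]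
  obtain rfl := hsph.eq_top N hN
  exact ⟨(e.trans (LieModuleEquiv.ofTop ℂ L (V g χ))).symm⟩

/-- The trivial `L`-module is simple with a trivial `g`-type, so once it has character `χ` the
uniqueness result identifies it with `V(0, χ)`. -/
lemma nonempty_equiv_triv_iff :
    Nonempty (V g χ ≃ₗ⁅ℂ,L⁆ Triv L) ↔ HasRadCentralChar χ (Triv L) := by
  constructor
  · rintro ⟨e⟩
    exact (isSphericalVector_V χ).hasRadCentralChar.of_surjective
      (e : V g χ →ₗ⁅ℂ,L⁆ Triv L) e.surjective
  · intro h
    have h1 : (TrivialLieModule.equiv ℂ L ℂ).symm 1 ≠ 0 :=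
      (LinearEquiv.map_ne_zero_iff _).mpr one_ne_zero
    obtain ⟨N, -, hN⟩ := exists_equiv_triv (L := g) h1 fun x => rfl
    obtain ⟨e⟩ := nonempty_equiv_V hLevi hab χ isIrreducible_triv h ⟨N, hN⟩
    exact ⟨e.symm⟩

end Main

end GenTakiff

end

theorem proposition6p5 {L : Type*} [LieRing L] [LieAlgebra ℂ L] [FiniteDimensional ℂ L]
    (g : LieSubalgebra ℂ L) [LieAlgebra.IsSemisimple ℂ g]
    (hLevi : IsCompl g.toSubmodule (LieAlgebra.radical ℂ L).toSubmodule)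
    (hab : IsLieAbelian (LieAlgebra.radical ℂ L))
    (χ : RadCentralChar L) :
    -- `V(0, χ)` is the unique simple quotient of `Q(0, χ)`
    (∀ N : LieSubmodule ℂ L (Q g χ), LieModule.IsIrreducible ℂ L (Q g χ ⧸ N) ↔ N = maxSub g χ) ∧
    -- `V(0, χ)` is simple, has character `χ`, and has the trivial `g`-module as a `g`-type
    (LieModule.IsIrreducible ℂ L (V g χ) ∧ HasRadCentralChar χ (V g χ) ∧
      HasType g (V g χ) (Triv g)) ∧
    -- and every such module is isomorphic to it
    (∀ (W : Type*) [AddCommGroup W] [Module ℂ W] [LieRingModule L W] [LieModule ℂ L W],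
      LieModule.IsIrreducible ℂ L W → HasRadCentralChar χ W → HasType g W (Triv g) →
        Nonempty (W ≃ₗ⁅ℂ, L⁆ V g χ)) ∧
    -- if `[g, r] = r`, then `V(0, χ)` is trivial or infinite-dimensional
    (Submodule.span ℂ {z : L | ∃ x ∈ g, ∃ y ∈ LieAlgebra.radical ℂ L, ⁅x, y⁆ = z} =
        (LieAlgebra.radical ℂ L).toSubmodule →
      (Nonempty (V g χ ≃ₗ⁅ℂ, L⁆ Triv L) ∨ ¬ FiniteDimensional ℂ (V g χ)) ∧
      (Nonempty (V g χ ≃ₗ⁅ℂ, L⁆ Triv L) ↔ HasRadCentralChar χ (Triv L))) ∧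
    -- `V(0, χ)` is a `g`-Harish-Chandra module
    IsHarishChandra g (V g χ) := by
  have hirr := isIrreducible_V hLevi hab χ
  refine ⟨isIrreducible_quotient_iff (maxSub_ne_top hLevi hab χ),
    ⟨hirr, (isSphericalVector_V χ).hasRadCentralChar, hasType_V hLevi hab χ⟩,
    fun W _ _ _ _ hW hχ htype => nonempty_equiv_V hLevi hab χ hW hχ htype, fun hgr => ⟨?_, ?_⟩,
    (isSphericalVector_V χ).isHarishChandra hLevi hab⟩
  · by_cases hfd : FiniteDimensional ℂ (V g χ)
    · exact Or.inl (nonempty_equiv_triv hLevi hab χ hgr)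
    · exact Or.inr hfd
  · exact nonempty_equiv_triv_iff hLevi hab χ
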